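/- Let $\mathbb H^2$ be the upper half plane with the metric $|dz|^2/\mathrm{Im}(z)^2$ and the area form $d\mathrm A=\frac{dx\wedge dy}{y^2}$, and let $p:\widetilde{\mathbb{A}\mathrm{d}\mathbb{S}^3}\to \mathrm{PSL}_2\mathbb R$ be the universal cover, endowed with the pullback of $\frac18$ of the bi-invariant Lorentzian metric given by the Killing form. The time-orientation is the one for which the generators of the counterclockwise rotation groups of $\mathbb H^2$ are future directed. Let $T^1_\star$ be the bundle of future-directed unit timelike tangent vectors $(\gamma,u)$ of $\widetilde{\mathbb{A}\mathrm{d}\mathbb{S}^3}$, let $g_S$ be its Sasaki metric, let $\mathbb R$ act on $T^1_\star$ by the geodesic flow with generator $\chi$, and let $\omega=-g_S(\chi,\cdot)$. Let $\pi:T^1_\star\to\mathbb H^2\times\mathbb H^2$ send $(\gamma,u)$ to the unique $(x,y)$ such that the geodesic with initial data $(\gamma,u)$ is mapped by $p$ onto the timelike geodesic $L_{x,y}=\{g\in \mathrm{PSL}_2\mathbb R: g(y)=x\}$. Let $\Gamma$ be a group (for instance $\Gamma=\pi_1(S)$ for a closed oriented surface $S$ of negative Euler characteristic), and let $\rho_l,\rho_r:\Gamma\to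 \mathrm{PSL}_2\mathbb R$ be Fuchsian representations, i.e. such that $\Gamma$ acts through each of them freely and properly discontinuously on $\mathbb H^2$. Let $\mathrm{PSL}_2\mathbb R\times \mathrm{PSL}_2\mathbb R$ act on $\mathrm{PSL}_2\mathbb R$ by $(\alpha,\beta)\cdot g=\alpha g\beta^{-1}$, and let $\widetilde\rho:\Gamma\to\mathrm{Isom}_0(\widetilde{\mathbb{A}\mathrm{d}\mathbb{S}^3})$ be any lift of $\rho=(\rho_l,\rho_r)$, for instance the standard one. Let $P_\rho=T^1_\star/\widetilde\rho(\Gamma)$, let $S_l=\mathbb H^2/\rho_l(\Gamma)$ and $S_r=\mathbb H^2/\rho_r(\Gamma)$, with the area forms $\Omega_l$ and $\Omega_r$ induced by $d\mathrm A$, let $\pi_\rho:P_\rho\to S_l\times S_r$ be the map induced by $\pi$, and let $\omega_\rho$ be the $1$-form on $P_\rho$ induced by $\omega$. (The form $\omega_\rho$ is a connection form for the principal $\mathbb R$-bundle $P_\rho\to(\mathbb H^2\times\mathbb H^2)/\rho(\Gamma)$ given by the geodesic flow; $\pi_\rho$ is its projection followed by the covering $(\mathbb H^2\times\mathbb H^2)/\rho(\Gamma)\to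 S_l\times S_r$.) Then the curvature $R_\rho=d\omega_\rho$ is $$R_\rho=\tfrac12\,\pi_\rho^*\Omega_\rho,\qquad \Omega_\rho=p_l^*\Omega_l-p_r^*\Omega_r,$$ where $p_l,p_r$ are the projections of $S_l\times S_r$ onto its two factors. -/

import Mathlib

open scoped Manifold ContDiff MatrixGroups UpperHalfPlane

noncomputable section

/-! ### Differential forms on manifolds without boundary -/

/-- Differential `k`-forms (not necessarily smooth) on a real manifold. -/
abbrev DiffForm {E H : Type*} [NormedAddCommGroup E] [NormedSpace ℝ E] [TopologicalSpace H]
    (I : ModelWithCorners ℝ E H) (M : Type*) [TopologicalSpace M] [ChartedSpace H M] (k : ℕ) :=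
  ∀ x : M, TangentSpace I x [⋀^Fin k]→L[ℝ] ℝ

namespace DiffForm

variable {E H : Type*} [NormedAddCommGroup E] [NormedSpace ℝ E] [TopologicalSpace H]
  {I : ModelWithCorners ℝ E H} {M : Type*} [TopologicalSpace M] [ChartedSpace H M]
  {E' H' : Type*} [NormedAddCommGroup E'] [NormedSpace ℝ E'] [TopologicalSpace H']
  {J : ModelWithCorners ℝ E' H'} {N : Type*} [TopologicalSpace N] [ChartedSpace H' N] {k : ℕ}

/-- The pullback `f^*η` of a differential form. -/
def pullback (f : M → N) (η : DiffForm J N k) : DiffForm I M k := fun x =>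
  (η (f x)).compContinuousLinearMap (mfderiv I J f x)

/-- The exterior derivative of a form on a manifold modelled on a normed space: at `x`, write the
form in the preferred chart around `x`, differentiate it there, and transport the result back. -/
def extDeriv {M : Type*} [TopologicalSpace M] [ChartedSpace E M] (η : DiffForm 𝓘(ℝ, E) M k) :
    DiffForm 𝓘(ℝ, E) M (k + 1) := fun x =>
  (_root_.extDeriv (fun y : E => (η ((chartAt E x).symm y)).compContinuousLinearMap
      (mfderiv 𝓘(ℝ, E) 𝓘(ℝ, E) (chartAt E x).symm y)) (chartAt E x x)).compContinuousLinearMap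
    (mfderiv 𝓘(ℝ, E) 𝓘(ℝ, E) (chartAt E x) x)

end DiffForm

/-! ### Quotient manifolds -/

/-- The manifold structure on the target of a surjective local homeomorphism `q`: the charts are
the local inverses of `q` followed by charts of the source. -/
@[reducible]
def IsLocalHomeomorph.quotientChartedSpace {H X Y : Type*} [TopologicalSpace H]
    [TopologicalSpace X] [ChartedSpace H X] [TopologicalSpace Y] {q : X → Y}
    (hq : IsLocalHomeomorph q) (hs : Function.Surjective q) : ChartedSpace H Y where
  atlas := {c | ∃ (x : X) (e : OpenPartialHomeomorph X Y),
    x ∈ e.source ∧ q = e ∧ c = e.symm.trans (chartAt H x)}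
  chartAt y := (hq (Function.surjInv hs y)).choose.symm.trans (chartAt H (Function.surjInv hs y))
  mem_chart_source y := by
    have h := (hq (Function.surjInv hs y)).choose_spec
    set e := (hq (Function.surjInv hs y)).choose with he
    have hy : e (Function.surjInv hs y) = y := by
      rw [← congrFun h.2]; exact Function.surjInv_eq hs y
    have h1 : y ∈ e.target := by
      have := e.map_source h.1
      rwa [hy] at this
    have h2 : e.symm y = Function.surjInv hs y := by
      have := e.left_inv h.1
      rwa [hy] at this
    simp only [OpenPartialHomeomorph.trans_source, OpenPartialHomeomorph.symm_source,
      Set.mem_inter_iff, Set.mem_preimage]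
    refine ⟨h1, ?_⟩
    rw [h2]
    exact mem_chart_source H _
  chart_mem_atlas y :=
    ⟨_, _, (hq (Function.surjInv hs y)).choose_spec.1,
      (hq (Function.surjInv hs y)).choose_spec.2, rfl⟩

/-- If `G` acts freely, properly discontinuously and continuously then `X → X / G` is a local
homeomorphism. -/
theorem isLocalHomeomorph_orbit_mk {G X : Type*} [Group G] [TopologicalSpace X] [MulAction G X]
    [ContinuousConstSMul G X] [ProperlyDiscontinuousSMul G X] [LocallyCompactSpace X] [T2Space X]
    (hfree : ∀ (g : G) (x : X), g • x = x → g = 1) :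
    IsLocalHomeomorph (Quotient.mk (MulAction.orbitRel G X)) := by
  have : IsCancelSMul G X := isCancelSMul_iff_eq_one_of_smul_eq.mpr hfree
  exact (isQuotientCoveringMap_quotientMk_of_properlyDiscontinuousSMul
    (E := X) (G := G)).isCoveringMap.isLocalHomeomorph

/-! ### The hyperbolic plane -/

/-- The centre of `SL(2, ℝ)` acts trivially on the upper half plane. -/
theorem center_smul_upperHalfPlane (g : SL(2, ℝ)) (hg : g ∈ Subgroup.center SL(2, ℝ)) (z : ℍ) :
    g • z = z := by
  obtain ⟨r, hr, hg⟩ := Matrix.SpecialLinearGroup.mem_center_iff.mp hg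
  have hr0 : (r : ℂ) ≠ 0 := by
    intro h
    have : r = 0 := by exact_mod_cast h
    simp [this] at hr
  apply UpperHalfPlane.ext
  rw [UpperHalfPlane.coe_specialLinearGroup_apply]
  have h00 : g 0 0 = r := by rw [← hg]; simp
  have h01 : g 0 1 = 0 := by rw [← hg]; simp
  have h10 : g 1 0 = 0 := by rw [← hg]; simp
  have h11 : g 1 1 = r := by rw [← hg]; simp
  simp [h00, h01, h10, h11]
  field_simp

/-- `PSL(2, ℝ)` acts on the upper half plane by Möbius transformations. -/
instance pslAction : MulAction PSL(2, ℝ) ℍ :=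
  MulAction.compHom ℍ (QuotientGroup.lift (Subgroup.center SL(2, ℝ))
    (MulAction.toPermHom SL(2, ℝ) ℍ) (fun g hg => by
      ext z; exact congrArg _ (center_smul_upperHalfPlane g hg z)))

theorem psl_mk_smul (g : SL(2, ℝ)) (z : ℍ) :
    (QuotientGroup.mk g : PSL(2, ℝ)) • z = g • z := rfl

/-- The area form `dx ∧ dy / y²` of the hyperbolic metric `|dz|² / y²` on the upper half plane. -/
def hyperbolicAreaForm : DiffForm 𝓘(ℝ, ℂ) ℍ 2 := fun z =>
  (1 / z.im ^ 2) • ContinuousMultilinearMap.alternatization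
    ((ContinuousMultilinearMap.mkPiAlgebra ℝ (Fin 2) ℝ).compContinuousLinearMap
      ![Complex.reCLM, Complex.imCLM])

/-- A representation is Fuchsian (without torsion) if it makes the group act freely and properly
discontinuously on the hyperbolic plane; in particular it is faithful with discrete image. -/
class IsFuchsian {Γ : Type*} [Group Γ] (ρ : Γ →* PSL(2, ℝ)) : Prop where
  free : ∀ (τ : Γ) (z : ℍ), ρ τ • z = z → τ = 1
  finite : ∀ K L : Set ℍ, IsCompact K → IsCompact L →
    {τ : Γ | ((fun z => ρ τ • z) '' K ∩ L).Nonempty}.Finite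

instance pslContinuous : ContinuousConstSMul PSL(2, ℝ) ℍ where
  continuous_const_smul g := by
    induction g using QuotientGroup.induction_on with
    | H g => exact continuous_const_smul (g : SL(2, ℝ))

instance (G : Subgroup PSL(2, ℝ)) : ContinuousConstSMul G ℍ where
  continuous_const_smul g := continuous_const_smul (g : PSL(2, ℝ))

section
variable {Γ : Type*} [Group Γ] (ρ : Γ →* PSL(2, ℝ))

/-- The hyperbolic surface `ℍ / ρ(Γ)`. -/
abbrev FuchsianSurface : Type := MulAction.orbitRel.Quotient ρ.range ℍ

instance [IsFuchsian ρ] : ProperlyDiscontinuousSMul ρ.range ℍ where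
  finite_disjoint_inter_image {K L} hK hL := by
    refine ((IsFuchsian.finite (ρ := ρ) K L hK hL).image ρ.rangeRestrict).subset ?_
    rintro ⟨_, τ, rfl⟩ h
    exact ⟨τ, h, rfl⟩

theorem FuchsianSurface.isLocalHomeomorph_mk [IsFuchsian ρ] :
    IsLocalHomeomorph (Quotient.mk (MulAction.orbitRel ρ.range ℍ)) := by
  refine isLocalHomeomorph_orbit_mk ?_
  rintro ⟨_, τ, rfl⟩ z h
  have := IsFuchsian.free (ρ := ρ) τ z h
  ext; simp [this]

instance [IsFuchsian ρ] : ChartedSpace ℂ (FuchsianSurface ρ) :=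
  (FuchsianSurface.isLocalHomeomorph_mk ρ).quotientChartedSpace Quotient.mk_surjective

end
/-! ### The universal cover of anti-de Sitter space -/

/-- The Lie algebra `sl(2, ℝ)`. -/
abbrev sl2 := LieAlgebra.SpecialLinear.sl (Fin 2) ℝ

/-- The manifold `ℂ × ℝ`, with points `(β, φ)`, underlying the universal cover of `PSL(2, ℝ)`; the
covering map is `adsCover` below. -/
abbrev AdS : Type := ℂ × ℝ

/-- `√(1 + |β|²)` as a function of `(β, φ)`. -/
def adsRadius (x : AdS) : ℝ := √(1 + x.1.re ^ 2 + x.1.im ^ 2)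

theorem adsRadius_sq (x : AdS) : adsRadius x ^ 2 = 1 + x.1.re ^ 2 + x.1.im ^ 2 :=
  Real.sq_sqrt (by positivity)

theorem adsRadius_pos (x : AdS) : 0 < adsRadius x := Real.sqrt_pos.mpr (by positivity)

/-- The universal covering map `ℂ × ℝ → SL(2, ℝ)`. Every matrix in `SL(2, ℝ)` is in a unique way
the sum of a matrix `(a, b; -b, a)` and a matrix `(c, d; d, -c)`, where `a² + b² = 1 + c² + d²`;
here `β = c + di`, and `φ` is the (lifted) argument of `a + bi`. So `SL(2, ℝ)` is diffeomorphic to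
`ℂ × ℝ/2πℤ`, and this map is the universal covering. -/
def slCover (x : AdS) : SL(2, ℝ) :=
  ⟨!![adsRadius x * Real.cos x.2 + x.1.re, adsRadius x * Real.sin x.2 + x.1.im;
      -(adsRadius x * Real.sin x.2) + x.1.im, adsRadius x * Real.cos x.2 - x.1.re], by
    rw [Matrix.det_fin_two_of]
    linear_combination (adsRadius x ^ 2) * Real.sin_sq_add_cos_sq x.2 + adsRadius_sq x⟩

/-- The universal covering map `p : ℂ × ℝ → PSL(2, ℝ)`. -/
def adsCover (x : AdS) : PSL(2, ℝ) := QuotientGroup.mk (slCover x)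

/-- The derivative of the covering map, with values in `2 × 2` matrices. -/
def slCoverDeriv (x : AdS) : AdS →ₗ[ℝ] Matrix (Fin 2) (Fin 2) ℝ where
  toFun v := Matrix.of fun i j => fderiv ℝ (fun y => slCover y i j) x v
  map_add' v w := by ext i j; simp
  map_smul' c v := by ext i j; simp

theorem contDiff_adsRadius : ContDiff ℝ ∞ adsRadius := by
  have h1 : ContDiff ℝ ∞ (fun x : AdS => x.1.re) := Complex.reCLM.contDiff.comp contDiff_fst
  have h2 : ContDiff ℝ ∞ (fun x : AdS => x.1.im) := Complex.imCLM.contDiff.comp contDiff_fst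
  unfold adsRadius
  exact ContDiff.sqrt (by fun_prop) (fun x => by positivity)

theorem contDiff_slCover (i j : Fin 2) : ContDiff ℝ ∞ (fun x : AdS => slCover x i j) := by
  have h1 : ContDiff ℝ ∞ (fun x : AdS => x.1.re) := Complex.reCLM.contDiff.comp contDiff_fst
  have h2 : ContDiff ℝ ∞ (fun x : AdS => x.1.im) := Complex.imCLM.contDiff.comp contDiff_fst
  have h3 := contDiff_adsRadius
  have h4 : ContDiff ℝ ∞ (fun x : AdS => Real.cos x.2) := Real.contDiff_cos.comp contDiff_snd
  have h5 : ContDiff ℝ ∞ (fun x : AdS => Real.sin x.2) := Real.contDiff_sin.comp contDiff_snd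
  fin_cases i <;> fin_cases j <;> simp [slCover] <;> fun_prop

theorem differentiable_slCover (i j : Fin 2) (x : AdS) :
    DifferentiableAt ℝ (fun x : AdS => slCover x i j) x :=
  (contDiff_slCover i j).differentiable (by simp) x

theorem slCover_det (x : AdS) :
    slCover x 0 0 * slCover x 1 1 - slCover x 0 1 * slCover x 1 0 = 1 := by
  have := (slCover x).2
  rwa [Matrix.det_fin_two] at this

theorem slCoverDeriv_det (x v : AdS) :
    slCoverDeriv x v 0 0 * slCover x 1 1 + slCover x 0 0 * slCoverDeriv x v 1 1
      - slCoverDeriv x v 0 1 * slCover x 1 0 - slCover x 0 1 * slCoverDeriv x v 1 0 = 0 := by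
  have h : HasFDerivAt (fun y => slCover y 0 0 * slCover y 1 1 - slCover y 0 1 * slCover y 1 0) _ x :=
    ((differentiable_slCover 0 0 x).hasFDerivAt.mul (differentiable_slCover 1 1 x).hasFDerivAt).sub
      ((differentiable_slCover 0 1 x).hasFDerivAt.mul (differentiable_slCover 1 0 x).hasFDerivAt)
  have h2 := h.unique ((hasFDerivAt_const (1 : ℝ) x).congr_of_eventuallyEq
    (Filter.Eventually.of_forall fun y => slCover_det y))
  have h3 := DFunLike.congr_fun h2 v
  simp at h3
  simp only [slCoverDeriv, LinearMap.coe_mk, AddHom.coe_mk, Matrix.of_apply]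
  linear_combination h3

theorem trace_inv_mul_slCoverDeriv (x v : AdS) :
    Matrix.trace (((slCover x)⁻¹ : SL(2, ℝ)).val * slCoverDeriv x v) = 0 := by
  rw [Matrix.SpecialLinearGroup.coe_inv, Matrix.adjugate_fin_two]
  simp only [Matrix.trace_fin_two, Matrix.mul_apply, Fin.sum_univ_two, Matrix.of_apply,
    Matrix.cons_val', Matrix.cons_val_zero, Matrix.cons_val_one, Matrix.cons_val_fin_one]
  linear_combination slCoverDeriv_det x v

/-- The left-invariant Maurer–Cartan form, i.e. the left translation of a tangent vector to the
identity: `v ↦ p(x)⁻¹ · dp_x(v)`. -/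
def leftTranslate (x : AdS) : AdS →ₗ[ℝ] sl2 where
  toFun v := ⟨((slCover x)⁻¹ : SL(2, ℝ)).val * slCoverDeriv x v,
    trace_inv_mul_slCoverDeriv x v⟩
  map_add' v w := by ext i j; simp [mul_add]
  map_smul' c v := by ext i j; simp

/-- The Lorentzian metric of the universal cover of anti-de Sitter space: the pullback of `1/8` of
the bi-invariant metric given by the Killing form. -/
def adsMetric (x : AdS) : AdS →ₗ[ℝ] AdS →ₗ[ℝ] ℝ :=
  (1 / 8 : ℝ) • (killingForm ℝ sl2).compl₁₂ (leftTranslate x) (leftTranslate x)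

/-- The Christoffel map of the Levi-Civita connection in the global coordinates: the bilinear map
determined by the Koszul formula. The covariant derivative of a vector field `u` along a curve `c`
is `u' + Γ(c', u)`. -/
def christoffel (x : AdS) : AdS →ₗ[ℝ] AdS →ₗ[ℝ] AdS :=
  Classical.epsilon fun G => ∀ v w z : AdS, 2 * adsMetric x (G v w) z =
    fderiv ℝ (fun y => adsMetric y w z) x v + fderiv ℝ (fun y => adsMetric y v z) x w
      - fderiv ℝ (fun y => adsMetric y v w) x z

/-- Geodesics of the universal cover of anti-de Sitter space, defined for all times. -/
def IsGeodesic (c : ℝ → AdS) : Prop :=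
  ContDiff ℝ ∞ c ∧ ∀ t, deriv (deriv c) t + christoffel (c t) (deriv c t) (deriv c t) = 0

/-- The unique geodesic with given initial point and initial velocity. -/
def geodesicFrom (m : AdS × AdS) : ℝ → AdS :=
  Classical.epsilon fun c => IsGeodesic c ∧ c 0 = m.1 ∧ deriv c 0 = m.2

/-- The geodesic flow. -/
def geodesicFlow (t : ℝ) (m : AdS × AdS) : AdS × AdS :=
  (geodesicFrom m t, deriv (geodesicFrom m) t)

/-- The generator of the geodesic flow, as a vector in the ambient space `AdS × AdS`. -/
def flowGenerator (m : AdS × AdS) : AdS × AdS := deriv (fun t => geodesicFlow t m) 0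

/-- A vector `(w, u̇)` tangent to the tangent bundle at `(γ, u)` is the sum of the horizontal lift
`(w, -Γ(w, u))` of `w` (the velocity of a curve of parallel vectors) and of the vertical vector
`(0, v)`, `v = u̇ + Γ(w, u)`. This map is the vertical part `(w, u̇) ↦ v`. -/
def verticalPart (m : AdS × AdS) : AdS × AdS →ₗ[ℝ] AdS :=
  LinearMap.snd ℝ AdS AdS + (christoffel m.1).flip m.2 ∘ₗ LinearMap.fst ℝ AdS AdS

/-- The Sasaki metric: horizontal and vertical vectors are orthogonal, and on each of the two
subspaces it is given by the metric of anti-de Sitter space. -/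
def sasakiMetric (m : AdS × AdS) : AdS × AdS →ₗ[ℝ] AdS × AdS →ₗ[ℝ] ℝ :=
  (adsMetric m.1).compl₁₂ (LinearMap.fst ℝ AdS AdS) (LinearMap.fst ℝ AdS AdS) +
    (adsMetric m.1).compl₁₂ (verticalPart m) (verticalPart m)

/-- The unit future timelike tangent bundle. The time orientation is the one for which the timelike
vector field `∂/∂φ` is future directed; equivalently, on `PSL(2, ℝ)`, the one for which the
generators of the counterclockwise rotation groups of the hyperbolic plane are future directed. -/
def UnitFutureTangent : Set (AdS × AdS) :=
  {m | adsMetric m.1 m.2 m.2 = -1 ∧ adsMetric m.1 m.2 (0, 1) < 0}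

/-! Explicit formulas for the metric. -/

theorem sl2_trace (A : sl2) : A.val 0 0 + A.val 1 1 = 0 := by
  have h : Matrix.trace A.val = 0 := A.2
  rwa [Matrix.trace_fin_two] at h

/-- The coordinates `(a, b, c)` of the matrix `(a, b; c, -a)`. -/
def sl2Coord : sl2 ≃ₗ[ℝ] (Fin 3 → ℝ) where
  toFun A := ![A.val 0 0, A.val 0 1, A.val 1 0]
  map_add' A B := by ext i; fin_cases i <;> simp
  map_smul' c A := by ext i; fin_cases i <;> simp
  invFun v := ⟨!![v 0, v 1; v 2, -v 0], by
    change Matrix.trace !![v 0, v 1; v 2, -v 0] = 0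
    simp [Matrix.trace_fin_two]⟩
  left_inv A := by
    have := sl2_trace A
    ext i j
    fin_cases i <;> fin_cases j <;> simp
    linarith
  right_inv v := by ext i; fin_cases i <;> simp

theorem killingForm_sl2 (A B : sl2) : killingForm ℝ sl2 A B = 4 * Matrix.trace (A.val * B.val) := by
  have hA := sl2_trace A
  have hB := sl2_trace B
  have hA' : A.val 1 1 = - A.val 0 0 := by linarith
  have hB' : B.val 1 1 = - B.val 0 0 := by linarith
  rw [killingForm_apply_apply, LinearMap.trace_eq_matrix_trace ℝ (Module.Basis.ofEquivFun sl2Coord)]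
  simp only [Matrix.trace, Matrix.diag, LinearMap.toMatrix_apply, Fin.sum_univ_three,
    Fin.sum_univ_two, Matrix.mul_apply, Module.Basis.ofEquivFun_repr_apply,
    Module.Basis.coe_ofEquivFun]
  have key : ∀ C : sl2, (⁅A, ⁅B, C⁆⁆ : sl2).val = A.val * (B.val * C.val - C.val * B.val)
      - (B.val * C.val - C.val * B.val) * A.val := fun C => rfl
  simp only [sl2Coord, LinearEquiv.coe_mk, LinearMap.coe_mk, AddHom.coe_mk, LinearMap.comp_apply,
    LieAlgebra.ad_apply, key, LinearEquiv.coe_symm_mk, Matrix.sub_apply, Matrix.mul_apply,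
    Fin.sum_univ_two, hA', hB']
  simp
  ring

/-- The differential of the radius function. -/
theorem adsRadius_fderiv (x v : AdS) :
    adsRadius x * fderiv ℝ adsRadius x v = x.1.re * v.1.re + x.1.im * v.1.im := by
  have hd := (contDiff_adsRadius.differentiable (by simp) x).hasFDerivAt
  have h1 : HasFDerivAt (fun x : AdS => x.1.re) (Complex.reCLM ∘L ContinuousLinearMap.fst ℝ ℂ ℝ) x :=
    (Complex.reCLM ∘L ContinuousLinearMap.fst ℝ ℂ ℝ).hasFDerivAt
  have h2 : HasFDerivAt (fun x : AdS => x.1.im) (Complex.imCLM ∘L ContinuousLinearMap.fst ℝ ℂ ℝ) x :=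
    (Complex.imCLM ∘L ContinuousLinearMap.fst ℝ ℂ ℝ).hasFDerivAt
  have h3 := (hd.pow 2).unique ((((h1.pow 2).const_add 1).add (h2.pow 2)).congr_of_eventuallyEq
    (Filter.Eventually.of_forall fun y => adsRadius_sq y))
  have h4 := DFunLike.congr_fun h3 v
  simp at h4
  linear_combination h4 / 2

theorem slCoverDeriv_eq (x v : AdS) : slCoverDeriv x v =
    !![fderiv ℝ adsRadius x v * Real.cos x.2 - adsRadius x * Real.sin x.2 * v.2 + v.1.re,
      fderiv ℝ adsRadius x v * Real.sin x.2 + adsRadius x * Real.cos x.2 * v.2 + v.1.im;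
      -(fderiv ℝ adsRadius x v * Real.sin x.2 + adsRadius x * Real.cos x.2 * v.2) + v.1.im,
      fderiv ℝ adsRadius x v * Real.cos x.2 - adsRadius x * Real.sin x.2 * v.2 - v.1.re] := by
  have hd := (contDiff_adsRadius.differentiable (by simp) x).hasFDerivAt
  have h1 : HasFDerivAt (fun x : AdS => x.1.re) (Complex.reCLM ∘L ContinuousLinearMap.fst ℝ ℂ ℝ) x :=
    (Complex.reCLM ∘L ContinuousLinearMap.fst ℝ ℂ ℝ).hasFDerivAt
  have h2 : HasFDerivAt (fun x : AdS => x.1.im) (Complex.imCLM ∘L ContinuousLinearMap.fst ℝ ℂ ℝ) x :=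
    (Complex.imCLM ∘L ContinuousLinearMap.fst ℝ ℂ ℝ).hasFDerivAt
  have h3 : HasFDerivAt (fun x : AdS => x.2) (ContinuousLinearMap.snd ℝ ℂ ℝ) x :=
    (ContinuousLinearMap.snd ℝ ℂ ℝ).hasFDerivAt
  have h4 := hd.mul h3.cos
  have h5 := hd.mul h3.sin
  have e00 := (h4.add h1).fderiv
  have e01 := (h5.add h2).fderiv
  have e10 := (h5.neg.add h2).fderiv
  have e11 := (h4.sub h1).fderiv
  ext i j
  fin_cases i <;> fin_cases j
  · have := DFunLike.congr_fun e00 v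
    simp at this
    simp [slCoverDeriv, slCover]
    refine Eq.trans this ?_
    ring
  · have := DFunLike.congr_fun e01 v
    simp at this
    simp [slCoverDeriv, slCover]
    refine Eq.trans this ?_
    ring
  · have := DFunLike.congr_fun e10 v
    simp at this
    simp [slCoverDeriv, slCover]
    refine Eq.trans this ?_
    ring
  · have := DFunLike.congr_fun e11 v
    simp at this
    simp [slCoverDeriv, slCover]
    refine Eq.trans this ?_
    ring

theorem adsMetric_eq_trace (x v w : AdS) : adsMetric x v w =
    (1 / 2) * Matrix.trace ((leftTranslate x v).val * (leftTranslate x w).val) := by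
  simp only [adsMetric, LinearMap.smul_apply, LinearMap.compl₁₂_apply, killingForm_sl2, smul_eq_mul]
  ring

theorem leftTranslate_val (x v : AdS) : (leftTranslate x v).val =
    !![slCover x 1 1, -slCover x 0 1; -slCover x 1 0, slCover x 0 0] * slCoverDeriv x v := by
  change ((slCover x)⁻¹ : SL(2, ℝ)).val * slCoverDeriv x v = _
  rw [Matrix.SpecialLinearGroup.coe_inv, Matrix.adjugate_fin_two]

theorem adsMetric_eq_det (x v w : AdS) : adsMetric x v w =
    -(1 / 2) * (slCoverDeriv x v 0 0 * slCoverDeriv x w 1 1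
      + slCoverDeriv x v 1 1 * slCoverDeriv x w 0 0
      - slCoverDeriv x v 0 1 * slCoverDeriv x w 1 0
      - slCoverDeriv x v 1 0 * slCoverDeriv x w 0 1) := by
  rw [adsMetric_eq_trace, leftTranslate_val, leftTranslate_val]
  have hv := slCoverDeriv_det x v
  have hw := slCoverDeriv_det x w
  have hd := slCover_det x
  simp only [Matrix.trace_fin_two, Matrix.mul_apply, Fin.sum_univ_two, Matrix.of_apply,
    Matrix.cons_val', Matrix.cons_val_zero, Matrix.cons_val_one, Matrix.cons_val_fin_one]
  generalize slCoverDeriv x v = X at *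
  generalize slCoverDeriv x w = Y at *
  linear_combination (1 / 2) * (X 0 0 * slCover x 1 1 + slCover x 0 0 * X 1 1
      - X 0 1 * slCover x 1 0 - slCover x 0 1 * X 1 0) * hw - (1 / 2) *
      (X 0 0 * Y 1 1 + X 1 1 * Y 0 0 - X 0 1 * Y 1 0 - X 1 0 * Y 0 1) * hd

theorem adsMetric_eq (x v w : AdS) : adsMetric x v w =
    v.1.re * w.1.re + v.1.im * w.1.im - fderiv ℝ adsRadius x v * fderiv ℝ adsRadius x w
      - adsRadius x ^ 2 * v.2 * w.2 := by
  rw [adsMetric_eq_det, slCoverDeriv_eq, slCoverDeriv_eq]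
  have hs := Real.sin_sq_add_cos_sq x.2
  simp only [Matrix.of_apply,
    Matrix.cons_val', Matrix.cons_val_zero, Matrix.cons_val_one, Matrix.cons_val_fin_one]
  linear_combination (-(fderiv ℝ adsRadius x v * fderiv ℝ adsRadius x w)
      - adsRadius x ^ 2 * v.2 * w.2) * hs

theorem adsRadius_fderiv' (x v : AdS) :
    fderiv ℝ adsRadius x v = (x.1.re * v.1.re + x.1.im * v.1.im) / adsRadius x := by
  rw [← adsRadius_fderiv]
  field_simp [(adsRadius_pos x).ne']

/-- The coordinate `u_φ` of a unit future timelike vector in terms of the others. -/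
def futureCoord (m : AdS × ℂ) : ℝ :=
  √(1 + m.2.re ^ 2 + m.2.im ^ 2
    - ((m.1.1.re * m.2.re + m.1.1.im * m.2.im) / adsRadius m.1) ^ 2) / adsRadius m.1

theorem futureCoord_aux (m : AdS × ℂ) : 0 < 1 + m.2.re ^ 2 + m.2.im ^ 2
    - ((m.1.1.re * m.2.re + m.1.1.im * m.2.im) / adsRadius m.1) ^ 2 := by
  have hr := adsRadius_sq m.1
  have hp := adsRadius_pos m.1
  rw [div_pow, hr, sub_pos, div_lt_iff₀ (by positivity)]
  nlinarith [sq_nonneg (m.1.1.re * m.2.im - m.1.1.im * m.2.re), sq_nonneg m.1.1.re,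
    sq_nonneg m.1.1.im, sq_nonneg m.2.re, sq_nonneg m.2.im]

theorem mem_unitFutureTangent_iff (m : AdS × AdS) :
    m ∈ UnitFutureTangent ↔ m.2.2 = futureCoord (m.1, m.2.1) := by
  have hp := adsRadius_pos m.1
  have h := futureCoord_aux (m.1, m.2.1)
  simp only [UnitFutureTangent, Set.mem_ofPred_eq, adsMetric_eq, adsRadius_fderiv', futureCoord]
  simp only at h
  generalize hD : 1 + m.2.1.re ^ 2 + m.2.1.im ^ 2
    - ((m.1.1.re * m.2.1.re + m.1.1.im * m.2.1.im) / adsRadius m.1) ^ 2 = D at h ⊢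
  constructor
  · rintro ⟨h1, h2⟩
    have h3 : 0 < m.2.2 := by
      by_contra hc
      push Not at hc
      have : 0 ≤ -(adsRadius m.1 ^ 2 * m.2.2) := by
        have := mul_nonneg (sq_nonneg (adsRadius m.1)) (neg_nonneg.mpr hc)
        linarith
      simp at h2
      linarith
    rw [eq_div_iff hp.ne', eq_comm, Real.sqrt_eq_iff_eq_sq h.le (by positivity)]
    subst hD
    linear_combination h1
  · intro h1
    have h3 : 0 < m.2.2 := by rw [h1]; positivity
    rw [eq_div_iff hp.ne', eq_comm, Real.sqrt_eq_iff_eq_sq h.le (by positivity)] at h1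
    constructor
    · subst hD
      linear_combination h1
    · have := mul_pos (pow_pos hp 2) h3
      simp
      linarith

theorem continuous_futureCoord : Continuous futureCoord := by
  have h := contDiff_adsRadius.continuous
  unfold futureCoord
  have h2 : ∀ m : AdS × ℂ, adsRadius m.1 ≠ 0 := fun m => (adsRadius_pos m.1).ne'
  have h3 : Continuous fun m : AdS × ℂ => adsRadius m.1 := h.comp continuous_fst
  refine Continuous.div (Real.continuous_sqrt.comp ?_) h3 h2
  refine Continuous.sub (by fun_prop) (Continuous.pow (Continuous.div (by fun_prop) h3 h2) 2)

/-- The global coordinates `(γ, u_β)` on the unit future timelike tangent bundle, a submanifold of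
the tangent bundle which is the graph of the smooth function `futureCoord`. -/
def unitFutureTangentHomeo : UnitFutureTangent ≃ₜ AdS × ℂ where
  toFun m := (m.1.1, m.1.2.1)
  invFun y := ⟨(y.1, y.2, futureCoord y), (mem_unitFutureTangent_iff _).mpr rfl⟩
  left_inv m := Subtype.ext (Prod.ext rfl (Prod.ext rfl
    ((mem_unitFutureTangent_iff m.1).mp m.2).symm))
  right_inv _ := rfl
  continuous_toFun := by fun_prop
  continuous_invFun := by
    have := continuous_futureCoord
    fun_prop

instance : Nonempty UnitFutureTangent := ⟨unitFutureTangentHomeo.symm 0⟩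

instance : ChartedSpace (AdS × ℂ) UnitFutureTangent :=
  unitFutureTangentHomeo.isOpenEmbedding.singletonChartedSpace

instance : LocallyCompactSpace UnitFutureTangent :=
  unitFutureTangentHomeo.isClosedEmbedding.locallyCompactSpace

/-! ### Isometries -/

/-- The identity component of the isometry group of the universal cover of anti-de Sitter space:
the diffeomorphisms that cover an isometry `γ ↦ α γ β⁻¹` of `PSL(2, ℝ)`. (It is the quotient of
`G × G`, `G` the universal covering group of `PSL(2, ℝ)`, by the diagonal of the centre of `G`.) -/
def adsIsom : Subgroup (Equiv.Perm AdS) where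
  carrier := {F | ContDiff ℝ ∞ F ∧ ContDiff ℝ ∞ F.symm ∧
    ∃ α β : PSL(2, ℝ), ∀ x, adsCover (F x) = α * adsCover x * β⁻¹}
  one_mem' := ⟨contDiff_id, contDiff_id, 1, 1, fun x => by simp⟩
  mul_mem' := by
    rintro F G ⟨hF, hF', α, β, h⟩ ⟨hG, hG', α', β', h'⟩
    refine ⟨hF.comp hG, hG'.comp hF', α * α', β * β', fun x => ?_⟩
    rw [Equiv.Perm.mul_apply, h, h']
    group
  inv_mem' := by
    rintro F ⟨hF, hF', α, β, h⟩
    refine ⟨hF', hF, α⁻¹, β⁻¹, fun x => ?_⟩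
    have := h (F.symm x)
    rw [Equiv.apply_symm_apply] at this
    change adsCover (F.symm x) = _
    rw [this]
    group

theorem adsIsom_contDiff (F : adsIsom) : ContDiff ℝ ∞ (F : Equiv.Perm AdS) := F.2.1

/-- An isometry is covered by matrices. -/
theorem adsIsom_lift (F : adsIsom) {α β : PSL(2, ℝ)}
    (h : ∀ x, adsCover ((F : Equiv.Perm AdS) x) = α * adsCover x * β⁻¹) :
    ∃ A B : SL(2, ℝ), (QuotientGroup.mk B : PSL(2, ℝ)) = β ∧
      ∀ x, slCover ((F : Equiv.Perm AdS) x) = A * slCover x * B⁻¹ := by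
  obtain ⟨A, rfl⟩ := QuotientGroup.mk_surjective α
  obtain ⟨B, rfl⟩ := QuotientGroup.mk_surjective β
  set Q : AdS → SL(2, ℝ) := fun x =>
    (A * slCover x * B⁻¹)⁻¹ * slCover ((F : Equiv.Perm AdS) x) with hQ
  have hmem : ∀ x, Q x ∈ Subgroup.center SL(2, ℝ) := fun x => by
    have := h x
    rw [hQ]
    exact QuotientGroup.eq.mp (by rw [← adsCover, h x]; rfl)
  have hcov : Continuous slCover :=
    Continuous.subtype_mk (continuous_matrix fun i j => (contDiff_slCover i j).continuous) _
  have hcont : Continuous fun x => Q x 0 0 := by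
    have h1 : Continuous Q := by
      have := hcov.comp (adsIsom_contDiff F).continuous
      fun_prop
    exact (continuous_subtype_val.comp h1).matrix_elem 0 0
  have hval : ∀ x, Q x 0 0 ^ 2 = 1 ∧ (Q x).val = Matrix.scalar (Fin 2) (Q x 0 0) := fun x => by
    obtain ⟨r, hr, hs⟩ := Matrix.SpecialLinearGroup.mem_center_iff.mp (hmem x)
    have : Q x 0 0 = r := by rw [← hs]; simp
    rw [this]
    exact ⟨by simpa using hr, hs.symm⟩
  rcases isPreconnected_univ.eq_one_or_eq_neg_one_of_sq_eq hcont.continuousOn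
    (fun x _ => (hval x).1) with h1 | h1
  · refine ⟨A, B, rfl, fun x => ?_⟩
    have : Q x = 1 := by
      have e : Q x 0 0 = 1 := h1 (Set.mem_univ x)
      refine Subtype.ext ((hval x).2.trans ?_)
      rw [e, map_one]
      rfl
    exact (inv_mul_eq_one.mp this).symm
  · refine ⟨-A, B, rfl, fun x => ?_⟩
    have : Q x = -1 := by
      have e : Q x 0 0 = -1 := h1 (Set.mem_univ x)
      refine Subtype.ext ((hval x).2.trans ?_)
      rw [e, map_neg, map_one]
      rfl
    have h2 := congrArg (fun y => (A * slCover x * B⁻¹) * y) this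
    simp only [hQ, mul_inv_cancel_left] at h2
    rw [h2]
    apply Subtype.ext
    simp

theorem leftTranslate_isom (F : adsIsom) (A B : SL(2, ℝ))
    (h : ∀ x, slCover ((F : Equiv.Perm AdS) x) = A * slCover x * B⁻¹) (x v : AdS) :
    (leftTranslate ((F : Equiv.Perm AdS) x) (fderiv ℝ (F : Equiv.Perm AdS) x v)).val =
      B.val * (leftTranslate x v).val * (B⁻¹ : SL(2, ℝ)).val := by
  have hF := (adsIsom_contDiff F).differentiable (by simp) x
  have hd : slCoverDeriv ((F : Equiv.Perm AdS) x) (fderiv ℝ (F : Equiv.Perm AdS) x v) =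
      A.val * slCoverDeriv x v * (B⁻¹ : SL(2, ℝ)).val := by
    ext i j
    have h1 := ((differentiable_slCover i j ((F : Equiv.Perm AdS) x)).hasFDerivAt.comp x
      hF.hasFDerivAt)
    have h2 : HasFDerivAt (fun y => ∑ l, (∑ k, A i k * slCover y k l) * (B⁻¹ : SL(2, ℝ)) l j) _ x :=
      HasFDerivAt.fun_sum (u := Finset.univ) fun l _ => (HasFDerivAt.fun_sum (u := Finset.univ)
        fun k _ => (differentiable_slCover k l x).hasFDerivAt.const_mul (A i k)).mul_const _
    have h3 := h1.unique (h2.congr_of_eventuallyEq (Filter.Eventually.of_forall fun y => by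
      change slCover ((F : Equiv.Perm AdS) y) i j = _
      rw [h y]
      simp [Matrix.mul_apply]))
    have h4 := DFunLike.congr_fun h3 v
    simp only [Fin.sum_univ_two, add_apply, smul_apply,
      ContinuousLinearMap.comp_apply, smul_eq_mul] at h4
    simp only [slCoverDeriv, LinearMap.coe_mk, AddHom.coe_mk, Matrix.mul_apply, Matrix.of_apply,
      Fin.sum_univ_two]
    rw [h4]
    ring
  change ((slCover ((F : Equiv.Perm AdS) x))⁻¹ : SL(2, ℝ)).val * _ = _
  rw [hd, h x]
  change _ = B.val * (((slCover x)⁻¹ : SL(2, ℝ)).val * slCoverDeriv x v) * _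
  have : (A * slCover x * B⁻¹)⁻¹ * A = B * (slCover x)⁻¹ := by group
  have h5 := congrArg Subtype.val this
  simp only [Matrix.SpecialLinearGroup.coe_mul] at h5
  rw [← Matrix.mul_assoc, ← Matrix.mul_assoc, h5]
  simp only [Matrix.mul_assoc]

/-- A unit timelike vector is future directed if and only if its left translate `(a, b; c, -a)`
satisfies `c < b`. -/
theorem mem_unitFutureTangent_iff_leftTranslate (m : AdS × AdS) :
    m ∈ UnitFutureTangent ↔ (leftTranslate m.1 m.2).val.det = 1 ∧
      (leftTranslate m.1 m.2).val 1 0 < 0 := by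
  have ht := sl2_trace (leftTranslate m.1 m.2)
  have hdet : (leftTranslate m.1 m.2).val.det = -adsMetric m.1 m.2 m.2 := by
    rw [adsMetric_eq_trace, Matrix.det_fin_two, Matrix.trace_fin_two]
    simp only [Matrix.mul_apply, Fin.sum_univ_two]
    linear_combination (1 / 2) * ((leftTranslate m.1 m.2).val 0 0
      + (leftTranslate m.1 m.2).val 1 1) * ht
  have hr := adsRadius_sq m.1
  have hp := adsRadius_pos m.1
  have hdiff : (leftTranslate m.1 m.2).val 0 1 - (leftTranslate m.1 m.2).val 1 0 =
      2 * (adsRadius m.1 ^ 2 * m.2.2 + m.1.1.im * m.2.1.re - m.1.1.re * m.2.1.im) := by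
    rw [leftTranslate_val, slCoverDeriv_eq]
    have hs := Real.sin_sq_add_cos_sq m.1.2
    simp only [slCover, Matrix.mul_apply, Fin.sum_univ_two, Matrix.of_apply,
      Matrix.cons_val', Matrix.cons_val_zero, Matrix.cons_val_one, Matrix.cons_val_fin_one]
    linear_combination 2 * adsRadius m.1 ^ 2 * m.2.2 * hs
  have hmem : m ∈ UnitFutureTangent ↔ adsMetric m.1 m.2 m.2 = -1 ∧ 0 < m.2.2 := by
    have : adsMetric m.1 m.2 (0, 1) = -(adsRadius m.1 ^ 2 * m.2.2) := by
      rw [adsMetric_eq, adsRadius_fderiv', adsRadius_fderiv']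
      simp
    simp only [UnitFutureTangent, Set.mem_ofPred_eq, this, Left.neg_neg_iff]
    rw [mul_pos_iff_of_pos_left (by positivity)]
  rw [hmem, hdet, neg_eq_iff_eq_neg]
  refine and_congr_right fun hu => ?_
  rw [hu, Matrix.det_fin_two] at hdet
  rw [adsMetric_eq, adsRadius_fderiv'] at hu
  generalize (leftTranslate m.1 m.2).val = L at *
  have hmul : L 0 1 * L 1 0 = -1 - L 0 0 ^ 2 := by linear_combination L 0 0 * ht - hdet
  have hsq : (adsRadius m.1 ^ 2 * m.2.2) ^ 2 = adsRadius m.1 ^ 2 + m.2.1.re ^ 2 + m.2.1.im ^ 2 +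
      (m.1.1.im * m.2.1.re - m.1.1.re * m.2.1.im) ^ 2 := by
    field_simp at hu
    linear_combination -hu + (m.2.1.re ^ 2 + m.2.1.im ^ 2) * hr
  have hpos : 0 < adsRadius m.1 ^ 2 := by positivity
  have key : 0 < m.2.2 ↔ 0 < L 0 1 - L 1 0 := by
    rw [hdiff, ← mul_pos_iff_of_pos_left hpos]
    have hlt : |m.1.1.im * m.2.1.re - m.1.1.re * m.2.1.im| < |adsRadius m.1 ^ 2 * m.2.2| := by
      apply sq_lt_sq.mp
      nlinarith [sq_nonneg m.2.1.re, sq_nonneg m.2.1.im]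
    generalize adsRadius m.1 ^ 2 * m.2.2 = y at *
    constructor
    · intro hy
      rw [abs_of_pos hy] at hlt
      have := (abs_lt.mp hlt).1
      linarith
    · intro hy
      by_contra hc
      push Not at hc
      rw [abs_of_nonpos hc] at hlt
      have := (abs_lt.mp hlt).2
      linarith
  rw [key]
  constructor
  · intro h
    by_contra hc
    push Not at hc
    nlinarith [sq_nonneg (L 0 0)]
  · intro h
    by_contra hc
    push Not at hc
    nlinarith [sq_nonneg (L 0 0)]

theorem isom_mem_unitFutureTangent (F : adsIsom) (m : AdS × AdS) (hm : m ∈ UnitFutureTangent) :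
    ((F : Equiv.Perm AdS) m.1, fderiv ℝ (F : Equiv.Perm AdS) m.1 m.2) ∈ UnitFutureTangent := by
  obtain ⟨α, β, h⟩ := F.2.2.2
  obtain ⟨A, B, -, hAB⟩ := adsIsom_lift F h
  rw [mem_unitFutureTangent_iff_leftTranslate] at hm ⊢
  have ht := sl2_trace (leftTranslate m.1 m.2)
  rw [leftTranslate_isom F A B hAB]
  generalize (leftTranslate m.1 m.2).val = L at *
  obtain ⟨h1, h2⟩ := hm
  refine ⟨by rw [Matrix.det_mul, Matrix.det_mul, B.2, B⁻¹.2, h1]; norm_num, ?_⟩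
  rw [Matrix.SpecialLinearGroup.coe_inv, Matrix.adjugate_fin_two]
  have hB := B.2
  rw [Matrix.det_fin_two] at hB h1
  simp only [Matrix.mul_apply, Fin.sum_univ_two, Matrix.of_apply,
    Matrix.cons_val', Matrix.cons_val_zero, Matrix.cons_val_one, Matrix.cons_val_fin_one]
  generalize B.val = b at *
  have e : L 1 0 * ((b 1 0 * L 0 0 + b 1 1 * L 1 0) * b 1 1
      + (b 1 0 * L 0 1 + b 1 1 * L 1 1) * -b 1 0) = (L 1 0 * b 1 1 + L 0 0 * b 1 0) ^ 2 + b 1 0 ^ 2 := by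
    linear_combination b 1 0 ^ 2 * h1 - (b 1 0 ^ 2 * L 0 0 + b 1 0 * b 1 1 * L 1 0) * ht
  have e2 : 0 < (L 1 0 * b 1 1 + L 0 0 * b 1 0) ^ 2 + b 1 0 ^ 2 := by
    by_cases h0 : b 1 0 = 0
    · have h3 : b 1 1 ≠ 0 := by
        intro h3
        simp [h0, h3] at hB
      have : L 1 0 * b 1 1 ≠ 0 := mul_ne_zero h2.ne h3
      rw [h0]
      simp only [mul_zero, add_zero]
      positivity
    · positivity
  rw [← e] at e2
  exact neg_of_mul_pos_right e2 h2.le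

/-- Isometries act on the unit future timelike tangent bundle by their differentials. -/
instance : MulAction adsIsom UnitFutureTangent where
  smul F m := ⟨((F : Equiv.Perm AdS) m.1.1, fderiv ℝ (F : Equiv.Perm AdS) m.1.1 m.1.2),
    isom_mem_unitFutureTangent F m.1 m.2⟩
  one_smul m := by
    refine Subtype.ext (Prod.ext rfl ?_)
    change fderiv ℝ (id : AdS → AdS) m.1.1 m.1.2 = m.1.2
    simp
  mul_smul F G m := by
    refine Subtype.ext (Prod.ext rfl ?_)
    change fderiv ℝ ((F : Equiv.Perm AdS) ∘ (G : Equiv.Perm AdS)) m.1.1 m.1.2 = _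
    rw [fderiv_comp _ ((adsIsom_contDiff F).differentiable (by simp) _)
      ((adsIsom_contDiff G).differentiable (by simp) _)]
    rfl

theorem unitFutureTangent_smul_coe (F : adsIsom) (m : UnitFutureTangent) : (F • m).1 =
    ((F : Equiv.Perm AdS) m.1.1, fderiv ℝ (F : Equiv.Perm AdS) m.1.1 m.1.2) := rfl

instance : ContinuousConstSMul adsIsom UnitFutureTangent where
  continuous_const_smul F := by
    refine Continuous.subtype_mk ?_ _
    have h1 := adsIsom_contDiff F
    have h2 := h1.continuous
    have h3 := h1.continuous_fderiv (by simp)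
    refine Continuous.prodMk (by fun_prop) ?_
    exact (h3.comp (by fun_prop)).clm_apply (by fun_prop)

instance (G : Subgroup adsIsom) : ContinuousConstSMul G UnitFutureTangent where
  continuous_const_smul g := continuous_const_smul (g : adsIsom)

/-! ### Representations and the principal bundle -/

/-- The fixed point `y ∈ ℍ` of the one-parameter group of elliptic elements generated by the left
translate `(a, b; c, -a)` of a future unit timelike vector. -/
def rightPoint (m : UnitFutureTangent) : ℍ :=
  ⟨((leftTranslate m.1.1 m.1.2).val 0 0 - Complex.I) / (leftTranslate m.1.1 m.1.2).val 1 0, by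
    have h := ((mem_unitFutureTangent_iff_leftTranslate m.1).mp m.2).2
    rw [Complex.div_ofReal_im]
    simpa using div_pos_of_neg_of_neg (neg_neg_of_pos one_pos) h⟩

theorem continuous_leftTranslate (i j : Fin 2) :
    Continuous fun m : AdS × AdS => (leftTranslate m.1 m.2).val i j := by
  have h1 : ∀ i j, Continuous fun m : AdS × AdS => slCover m.1 i j := fun i j =>
    (contDiff_slCover i j).continuous.comp continuous_fst
  have h2 : ∀ i j, Continuous fun m : AdS × AdS => slCoverDeriv m.1 m.2 i j := fun i j =>
    (((contDiff_slCover i j).continuous_fderiv (by simp)).comp continuous_fst).clm_apply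
      continuous_snd
  simp only [leftTranslate_val, Matrix.mul_apply, Fin.sum_univ_two]
  refine Continuous.add (Continuous.mul ?_ (h2 _ _)) (Continuous.mul ?_ (h2 _ _)) <;>
  fin_cases i <;> simp <;> first | exact h1 _ _ | exact (h1 _ _).neg

theorem continuous_rightPoint : Continuous rightPoint := by
  rw [UpperHalfPlane.isOpenEmbedding_coe.isInducing.continuous_iff]
  have h1 := (Complex.continuous_ofReal.comp
    ((continuous_leftTranslate 0 0).comp continuous_subtype_val) : Continuous fun
      m : UnitFutureTangent => (((leftTranslate m.1.1 m.1.2).val 0 0 : ℝ) : ℂ))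
  have h2 := (Complex.continuous_ofReal.comp
    ((continuous_leftTranslate 1 0).comp continuous_subtype_val) : Continuous fun
      m : UnitFutureTangent => (((leftTranslate m.1.1 m.1.2).val 1 0 : ℝ) : ℂ))
  refine (h1.sub continuous_const).div h2 fun m => ?_
  exact_mod_cast ((mem_unitFutureTangent_iff_leftTranslate m.1).mp m.2).2.ne

theorem rightPoint_smul (F : adsIsom) {α β : PSL(2, ℝ)}
    (h : ∀ x, adsCover ((F : Equiv.Perm AdS) x) = α * adsCover x * β⁻¹) (m : UnitFutureTangent) :
    rightPoint (F • m) = β • rightPoint m := by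
  obtain ⟨A, B, rfl, hAB⟩ := adsIsom_lift F h
  rw [psl_mk_smul]
  apply UpperHalfPlane.ext
  rw [UpperHalfPlane.coe_specialLinearGroup_apply]
  have hm := (mem_unitFutureTangent_iff_leftTranslate _).mp m.2
  have hFm := (mem_unitFutureTangent_iff_leftTranslate _).mp (F • m).2
  change (((leftTranslate (F • m).1.1 (F • m).1.2).val 0 0 : ℂ) - Complex.I) /
    (leftTranslate (F • m).1.1 (F • m).1.2).val 1 0 = _
  have ht := sl2_trace (leftTranslate m.1.1 m.1.2)
  have hden := UpperHalfPlane.denom_ne_zero (B : GL (Fin 2) ℝ) (rightPoint m)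
  change (B 1 0 : ℂ) * (((leftTranslate m.1.1 m.1.2).val 0 0 - Complex.I) /
    (leftTranslate m.1.1 m.1.2).val 1 0) + B 1 1 ≠ 0 at hden
  change _ = ((B 0 0 : ℂ) * (((leftTranslate m.1.1 m.1.2).val 0 0 - Complex.I) /
    (leftTranslate m.1.1 m.1.2).val 1 0) + B 0 1) /
    ((B 1 0 : ℂ) * (((leftTranslate m.1.1 m.1.2).val 0 0 - Complex.I) /
    (leftTranslate m.1.1 m.1.2).val 1 0) + B 1 1)
  rw [unitFutureTangent_smul_coe] at hFm ⊢
  rw [leftTranslate_isom F A B hAB, Matrix.SpecialLinearGroup.coe_inv,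
    Matrix.adjugate_fin_two] at hFm ⊢
  have hB := B.2
  generalize (leftTranslate m.1.1 m.1.2).val = L at *
  obtain ⟨h1, h2⟩ := hm
  have h4 := hFm.2
  rw [Matrix.det_fin_two] at hB h1
  simp only [Matrix.mul_apply, Fin.sum_univ_two, Matrix.of_apply,
    Matrix.cons_val', Matrix.cons_val_zero, Matrix.cons_val_one, Matrix.cons_val_fin_one] at h4 ⊢
  change _ ≠ (0 : ℂ) at hden
  generalize B.val = b at *
  have hL11 : L 1 1 = -L 0 0 := by linarith
  rw [hL11] at h1 h4 ⊢
  have h2' : (L 1 0 : ℂ) ≠ 0 := by exact_mod_cast h2.ne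
  have h4' := h4.ne
  have h4'' : (((b 1 0 * L 0 0 + b 1 1 * L 1 0) * b 1 1
      + (b 1 0 * L 0 1 + b 1 1 * -L 0 0) * -b 1 0 : ℝ) : ℂ) ≠ 0 := by
    exact_mod_cast h4'
  rw [div_eq_div_iff h4'' hden]
  have h1' : (L 0 1 : ℂ) * L 1 0 = - L 0 0 ^ 2 - 1 := by
    have : L 0 1 * L 1 0 = - L 0 0 ^ 2 - 1 := by linarith
    exact_mod_cast this
  have hB' : (b 0 0 : ℂ) * b 1 1 - b 0 1 * b 1 0 = 1 := by exact_mod_cast hB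
  push_cast
  field_simp
  linear_combination (-(b 1 0 : ℂ) * (b 0 0 * b 1 1 - b 0 1 * b 1 0)) * h1'
    + (Complex.I * L 1 0 * b 1 1 - L 0 0 * b 1 0 * (L 0 0 - Complex.I)
      + ((L 0 0 : ℂ) ^ 2 + 1) * b 1 0) * hB' + (b 1 0 : ℂ) * Complex.I_sq

section
variable {Γ : Type*} [Group Γ] {ρl ρr : Γ →* PSL(2, ℝ)}

/-- A lift of `ρ = (ρl, ρr) : Γ → PSL(2, ℝ) × PSL(2, ℝ)`, where the pair `(α, β)` acts on
`PSL(2, ℝ)` by `γ ↦ α γ β⁻¹`, to isometries of the universal cover of anti-de Sitter space. -/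
structure IsomLift (ρl ρr : Γ →* PSL(2, ℝ)) where
  toHom : Γ →* adsIsom
  covers : ∀ (τ : Γ) (x : AdS),
    adsCover ((toHom τ : Equiv.Perm AdS) x) = ρl τ * adsCover x * (ρr τ)⁻¹

variable (ρ : IsomLift ρl ρr)

instance [IsFuchsian ρr] : ProperlyDiscontinuousSMul ρ.toHom.range UnitFutureTangent where
  finite_disjoint_inter_image {K L} hK hL := by
    refine ((IsFuchsian.finite (ρ := ρr) _ _ (hK.image continuous_rightPoint)
      (hL.image continuous_rightPoint)).image ρ.toHom.rangeRestrict).subset ?_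
    rintro ⟨_, τ, rfl⟩ ⟨_, ⟨m, hm, rfl⟩, hL⟩
    exact ⟨τ, ⟨_, ⟨_, ⟨m, hm, rfl⟩, rfl⟩, ⟨_, hL, rightPoint_smul _ (ρ.covers τ) m⟩⟩, rfl⟩

/-- The total space `P_ρ`, the quotient of the unit future timelike tangent bundle by `Γ`. -/
abbrev PrincipalBundle : Type := MulAction.orbitRel.Quotient ρ.toHom.range UnitFutureTangent

theorem PrincipalBundle.isLocalHomeomorph_mk [IsFuchsian ρr] :
    IsLocalHomeomorph (Quotient.mk (MulAction.orbitRel ρ.toHom.range UnitFutureTangent)) := by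
  refine isLocalHomeomorph_orbit_mk ?_
  rintro ⟨_, τ, rfl⟩ m h
  have h2 := rightPoint_smul _ (ρ.covers τ) m
  have h3 : ρ.toHom τ • m = m := h
  rw [h3] at h2
  have := IsFuchsian.free (ρ := ρr) τ _ h2.symm
  ext : 1
  simp [this]

instance [IsFuchsian ρr] : ChartedSpace (AdS × ℂ) (PrincipalBundle ρ) :=
  (PrincipalBundle.isLocalHomeomorph_mk ρ).quotientChartedSpace Quotient.mk_surjective

/-- The timelike geodesic `L_{x,y}` of anti-de Sitter space. -/
def timelikeGeodesic (x y : ℍ) : Set PSL(2, ℝ) := {γ | γ • y = x}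

/-- The projection `π` to `ℍ × ℍ`: it sends `(γ, u)` to the unique `(x, y)` such that the geodesic
with initial data `(γ, u)` projects to `L_{x,y}`. -/
def geodesicProj (m : UnitFutureTangent) : ℍ × ℍ :=
  Classical.epsilon fun z =>
    adsCover '' Set.range (geodesicFrom m.1) = timelikeGeodesic z.1 z.2

/-- The connection form `ω = -g_S(χ, ·)` on the unit future timelike tangent bundle, where `g_S` is
the Sasaki metric and `χ` the generator of the geodesic flow. -/
def connectionForm : DiffForm 𝓘(ℝ, AdS × ℂ) UnitFutureTangent 1 := fun m =>
  ContinuousAlternatingMap.ofSubsingleton ℝ (AdS × ℂ) ℝ 0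
    (-(LinearMap.toContinuousLinearMap (sasakiMetric m.1 (flowGenerator m.1)) ∘L
      mfderiv 𝓘(ℝ, AdS × ℂ) 𝓘(ℝ, AdS × AdS) (Subtype.val : UnitFutureTangent → AdS × AdS) m))

/-- The connection form `ω_ρ` on `P_ρ`: the unique form whose pullback is `ω`. -/
def bundleConnectionForm [IsFuchsian ρr] : DiffForm 𝓘(ℝ, AdS × ℂ) (PrincipalBundle ρ) 1 :=
  Classical.epsilon fun η =>
    η.pullback (Quotient.mk (MulAction.orbitRel ρ.toHom.range UnitFutureTangent)) = connectionForm

/-- The curvature of a connection form on a principal `ℝ`-bundle. As `ℝ` is abelian, the structure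
equation `R = dA + ½ [A ∧ A]` reduces to `R = dA`. -/
def connectionCurvature {E M : Type*} [NormedAddCommGroup E] [NormedSpace ℝ E] [TopologicalSpace M]
    [ChartedSpace E M] (A : DiffForm 𝓘(ℝ, E) M 1) : DiffForm 𝓘(ℝ, E) M 2 :=
  A.extDeriv

/-- The map `π_ρ` from `P_ρ` to `(ℍ / ρl(Γ)) × (ℍ / ρr(Γ))` induced by `π`. -/
def bundleProj : PrincipalBundle ρ → FuchsianSurface ρl × FuchsianSurface ρr :=
  Classical.epsilon fun F => ∀ m : UnitFutureTangent,
    F (Quotient.mk _ m) = (Quotient.mk _ (geodesicProj m).1, Quotient.mk _ (geodesicProj m).2)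

/-- The area form of the hyperbolic surface `ℍ / ρ(Γ)`: the unique form whose pullback to `ℍ` is the
hyperbolic area form. -/
def surfaceAreaForm (ρ : Γ →* PSL(2, ℝ)) [IsFuchsian ρ] :
    DiffForm 𝓘(ℝ, ℂ) (FuchsianSurface ρ) 2 :=
  Classical.epsilon fun η =>
    η.pullback (Quotient.mk (MulAction.orbitRel ρ.range ℍ)) = hyperbolicAreaForm

/-- The symplectic form `Ω_ρ = p_l^*Ω_l - p_r^*Ω_r`. -/
def surfaceSymplecticForm (ρl ρr : Γ →* PSL(2, ℝ)) [IsFuchsian ρl] [IsFuchsian ρr] :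
    DiffForm (𝓘(ℝ, ℂ).prod 𝓘(ℝ, ℂ)) (FuchsianSurface ρl × FuchsianSurface ρr) 2 :=
  (surfaceAreaForm ρl).pullback Prod.fst - (surfaceAreaForm ρr).pullback Prod.snd

end

end

/-! Write `g` for the matrix of a point of the universal cover and `N` for the matrix of a unit
timelike tangent vector at it. The form `-det` on `2 × 2` matrices is a flat metric of signature
`(2, 2)`, and the anti-de Sitter metric is its restriction to the quadric `det = 1`
(`adsMetric_eq_polarDet`). By the Gauss formula a geodesic is a curve whose matrix acceleration is
normal to the quadric, so unit timelike geodesics are the curves `cos t • g + sin t • N`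
(`IsGeodesic.slCover_eq`). The bundle is thus parametrised by pairs with `det g = det N = 1` and
`g`, `N` orthogonal for `polarDet`.

The flow generator is horizontal, so `ω` is `½ polarDet (N, dg)`. Its exterior derivative on vectors
with components `(g₁, N₁)`, `(g₂, N₂)` is `½ (polarDet N₁ g₂ - polarDet N₂ g₁)`, because the Hessian
of the covering map is symmetric (`extDeriv_connectionForm`).

The matrix `L = g⁻¹ N` is traceless of determinant one and the geodesic is `g exp(tL)`. It therefore
carries the fixed point `y` of `L` to the fixed point `x` of `g L g⁻¹ = N g⁻¹`, which identifies `π`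
(`geodesicProj_eq`). On the adjoint orbit of `L`, identified with the upper half plane by fixed
points, the invariant form `tr (L [L₁, L₂])` is four times the hyperbolic area
(`tripleTrace_tangent`). Comparing its values at `N g⁻¹` and at `g⁻¹ N` gives `polarDet N₁ g₂ -
polarDet N₂ g₁` as area at `x` minus area at `y` (`tripleTrace_twist`,
`symplectic_eq_area_sub_area`). The remaining factor `½` is the one in `ω`.

All the forms are invariant under the groups in play, so the identity passes to the quotients. Since
quotient charts are source charts composed with local inverses of the quotient map, every derivative
downstairs can be computed upstairs. -/

/-! ### Derivatives and differential forms on quotient manifolds -/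

section Quotient

variable {E F : Type*} [NormedAddCommGroup E] [NormedSpace ℝ E]
  [NormedAddCommGroup F] [NormedSpace ℝ F]
  {X Y : Type*} [TopologicalSpace X] [ChartedSpace E X] [TopologicalSpace Y] [ChartedSpace F Y]

/-- Differentiability of a map between manifolds modelled on normed spaces, in preferred charts. -/
theorem hasMFDerivAt_iff_chartAt {f : X → Y} {x : X} {f' : E →L[ℝ] F} :
    HasMFDerivAt 𝓘(ℝ, E) 𝓘(ℝ, F) f x f' ↔ ContinuousAt f x ∧
      HasFDerivAt (chartAt F (f x) ∘ f ∘ (chartAt E x).symm) f' (chartAt E x x) := by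
  simp only [HasMFDerivAt, writtenInExtChartAt, mfld_simps]
  exact and_congr_right' hasFDerivWithinAt_univ

/-- Evaluation of a pullback. -/
theorem DiffForm.pullback_apply_of_hasMFDerivAt {f : X → Y} {x : X} {f' : E →L[ℝ] F}
    (h : HasMFDerivAt 𝓘(ℝ, E) 𝓘(ℝ, F) f x f') {k : ℕ} (η : DiffForm 𝓘(ℝ, F) Y k) (v : Fin k → E) :
    η.pullback (I := 𝓘(ℝ, E)) f x v = η (f x) (fun i => f' (v i)) := by
  simp only [DiffForm.pullback]
  rw [h.mfderiv]
  rfl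

/-- A preferred chart has derivative the identity at the base point. -/
theorem hasMFDerivAt_chartAt (x : X) :
    HasMFDerivAt 𝓘(ℝ, E) 𝓘(ℝ, E) (chartAt E x) x (ContinuousLinearMap.id ℝ E) := by
  refine hasMFDerivAt_iff_chartAt.mpr
    ⟨(chartAt E x).continuousAt (mem_chart_source E x), ?_⟩
  refine (hasFDerivAt_id _).congr_of_eventuallyEq ?_
  filter_upwards [(chartAt E x).open_target.mem_nhds (mem_chart_target E x)] with y hy
  exact (chartAt E x).right_inv hy

/-- If all preferred charts of `Y` are given by the same function `j`, a map to `Y` is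
differentiable if its composition with `j` is. -/
theorem hasMFDerivAt_of_comp_chartAt {j : Y → F} (hj : ∀ y, ⇑(chartAt F y) = j) {f : X → Y}
    {x : X} {f' : E →L[ℝ] F} (hf : ContinuousAt f x)
    (h : HasMFDerivAt 𝓘(ℝ, E) 𝓘(ℝ, F) (j ∘ f) x f') :
    HasMFDerivAt 𝓘(ℝ, E) 𝓘(ℝ, F) f x f' := by
  refine hasMFDerivAt_iff_chartAt.mpr ⟨hf, ?_⟩
  rw [hj]
  exact (hasMFDerivAt_iff_chartAt.mp h).2

/-- The charts of the target `Y` of a local homeomorphism `q` are the local inverses of `q` at the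
values of a section `s`, followed by the charts of the source. -/
def IsQuotientCharted {E X Y : Type*} [NormedAddCommGroup E] [TopologicalSpace X]
    [ChartedSpace E X] [TopologicalSpace Y] [ChartedSpace E Y] (q : X → Y) (s : Y → X) : Prop :=
  ∀ y, q (s y) = y ∧ ∃ e : OpenPartialHomeomorph X Y, s y ∈ e.source ∧ q = e ∧
    chartAt E y = e.symm.trans (chartAt E (s y))

theorem IsLocalHomeomorph.isQuotientCharted {E X Y : Type*} [NormedAddCommGroup E]
    [TopologicalSpace X] [ChartedSpace E X] [TopologicalSpace Y] {q : X → Y}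
    (hq : IsLocalHomeomorph q) (hs : Function.Surjective q) :
    letI := hq.quotientChartedSpace (H := E) hs
    IsQuotientCharted (E := E) (X := X) q (Function.surjInv hs) := by
  intro y
  exact ⟨Function.surjInv_eq hs y, (hq (Function.surjInv hs y)).choose,
    (hq (Function.surjInv hs y)).choose_spec.1, (hq (Function.surjInv hs y)).choose_spec.2, rfl⟩

variable {Z : Type*} [TopologicalSpace Z] [ChartedSpace E Z] {q : X → Z} {s : Z → X}

/-- In preferred charts the quotient map is a deck transformation. -/
theorem IsQuotientCharted.hasMFDerivAt (h : IsQuotientCharted (E := E) q s) {x : X} {T : X → X}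
    (hT : T x = s (q x)) (hqT : ∀ y, q (T y) = q y) {T' : E →L[ℝ] E}
    (hT' : HasMFDerivAt 𝓘(ℝ, E) 𝓘(ℝ, E) T x T') :
    HasMFDerivAt 𝓘(ℝ, E) 𝓘(ℝ, E) q x T' := by
  obtain ⟨h1, e, he, hqe, hc⟩ := h (q x)
  have hT'' := hasMFDerivAt_iff_chartAt.mp hT'
  have hnear : ∀ᶠ y in nhds x, T y ∈ e.source :=
    hT''.1.eventually (e.open_source.mem_nhds (by rwa [hT]))
  refine hasMFDerivAt_iff_chartAt.mpr ⟨?_, ?_⟩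
  · have h2 : q = q ∘ T := funext fun y => (hqT y).symm
    rw [h2]
    refine ContinuousAt.comp ?_ hT''.1
    rw [hqe]
    exact e.continuousAt (by rwa [hT])
  · refine hT''.2.congr_of_eventuallyEq ?_
    have h3 : Filter.Tendsto (chartAt E x).symm (nhds (chartAt E x x)) (nhds x) := by
      have := (chartAt E x).continuousAt_symm (mem_chart_target E x)
      rwa [ContinuousAt, (chartAt E x).left_inv (mem_chart_source E x)] at this
    filter_upwards [h3.eventually hnear] with y hy
    simp only [hc, hT, Function.comp_apply, OpenPartialHomeomorph.coe_trans]
    -- Replacing `q` by `q ∘ T` puts the argument in the source of `e`, so `e.symm` cancels and `T`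
    -- is what remains of `q` in the charts. Only this one of the two occurrences of `q` may be
    -- unfolded to `e`.
    rw [← hqT ((chartAt E x).symm y)]
    nth_rw 2 [hqe]
    rw [e.left_inv hy]

/-- A form which is invariant under deck transformations descends to the quotient. -/
theorem IsQuotientCharted.exists_pullback_eq (h : IsQuotientCharted (E := E) q s) {k : ℕ}
    (η : DiffForm 𝓘(ℝ, E) X k)
    (hη : ∀ x x', q x = q x' → ∃ T : X → X, T x = x' ∧ (∀ y, q (T y) = q y) ∧
      MDifferentiableAt 𝓘(ℝ, E) 𝓘(ℝ, E) T x ∧ η.pullback (I := 𝓘(ℝ, E)) T x = η x) :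
    ∃ η' : DiffForm 𝓘(ℝ, E) Z k, η'.pullback (I := 𝓘(ℝ, E)) q = η := by
  -- The tangent space at `z` is coordinatised by the chart inherited from `s z`, so the value of
  -- `η` there is used unchanged. Invariance is needed to compare the value at `x` with that at `s
  -- (q x)`.
  refine ⟨fun z => η (s z), funext fun x => ?_⟩
  obtain ⟨T, h1, h2, h3, h4⟩ := hη x (s (q x)) (h (q x)).1.symm
  rw [← h4]
  simp only [DiffForm.pullback]
  rw [(h.hasMFDerivAt h1 h2 h3.hasMFDerivAt).mfderiv, ← h1]
  rfl

/-- Differentiation in the preferred chart of the quotient. -/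
theorem IsQuotientCharted.hasMFDerivAt_of_comp (h : IsQuotientCharted (E := E) q s) {f : Z → Y}
    (z : Z) {f' : E →L[ℝ] F}
    (hf : HasMFDerivAt 𝓘(ℝ, E) 𝓘(ℝ, F) (f ∘ q) (s z) f') :
    HasMFDerivAt 𝓘(ℝ, E) 𝓘(ℝ, F) f z f' := by
  obtain ⟨h1, e, he, hqe, hc⟩ := h z
  rw [hasMFDerivAt_iff_chartAt] at hf ⊢
  have hez : e.symm z = s z := by rw [← e.left_inv he, ← hqe, h1]
  refine ⟨?_, ?_⟩
  · have hz : z ∈ e.target := by rw [← h1, hqe]; exact e.map_source he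
    have h2 : f =ᶠ[nhds z] (f ∘ q) ∘ e.symm := by
      filter_upwards [e.open_target.mem_nhds hz] with y hy
      simp [hqe, e.right_inv hy]
    refine ContinuousAt.congr ?_ h2.symm
    refine ContinuousAt.comp ?_ (e.continuousAt_symm hz)
    rw [hez]
    exact hf.1
  · have h3 : chartAt E z z = chartAt E (s z) (s z) := by simp [hc, hez]
    rw [h3]
    refine hf.2.congr_of_eventuallyEq (Filter.Eventually.of_forall fun y => ?_)
    simp [hc, hqe.symm, h1]

end Quotient

/-! ### Möbius invariance of the hyperbolic area form, and its descent to surfaces -/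

section HyperbolicPlane

theorem hyperbolicAreaForm_apply (z : ℍ) (v : Fin 2 → ℂ) : hyperbolicAreaForm z v =
    (1 / z.im ^ 2) * ((v 0).re * (v 1).im - (v 1).re * (v 0).im) := by
  change ((1 / z.im ^ 2) • ContinuousMultilinearMap.alternatization
    ((ContinuousMultilinearMap.mkPiAlgebra ℝ (Fin 2) ℝ).compContinuousLinearMap
      ![Complex.reCLM, Complex.imCLM])) v = _
  rw [ContinuousAlternatingMap.smul_apply, ContinuousMultilinearMap.alternatization_apply_apply]
  rw [show (Finset.univ : Finset (Equiv.Perm (Fin 2))) = {1, Equiv.swap 0 1} by decide]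
  rw [Finset.sum_pair (by decide)]
  simp [Fin.prod_univ_two]
  left
  ring

theorem chartAt_upperHalfPlane (z : ℍ) : ⇑(chartAt ℂ z) = UpperHalfPlane.coe := rfl

theorem hasMFDerivAt_upperHalfPlane {E M : Type*} [NormedAddCommGroup E] [NormedSpace ℝ E]
    [TopologicalSpace M] [ChartedSpace E M] {f : M → ℍ} {x : M} {f' : E →L[ℝ] ℂ}
    (h : HasMFDerivAt 𝓘(ℝ, E) 𝓘(ℝ, ℂ) (fun y => (f y : ℂ)) x f') :
    HasMFDerivAt 𝓘(ℝ, E) 𝓘(ℝ, ℂ) f x f' :=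
  hasMFDerivAt_of_comp_chartAt chartAt_upperHalfPlane
    (UpperHalfPlane.isOpenEmbedding_coe.isInducing.continuousAt_iff.mpr h.1) h

theorem hasMFDerivAt_upperHalfPlane_coe (z : ℍ) :
    HasMFDerivAt 𝓘(ℝ, ℂ) 𝓘(ℝ, ℂ) UpperHalfPlane.coe z (ContinuousLinearMap.id ℝ ℂ) :=
  hasMFDerivAt_chartAt z

theorem hasMFDerivAt_smul_upperHalfPlane (g : SL(2, ℝ)) (z : ℍ) :
    HasMFDerivAt 𝓘(ℝ, ℂ) 𝓘(ℝ, ℂ) (fun w : ℍ => g • w) z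
      ((1 / ((g 1 0 : ℂ) * z + g 1 1) ^ 2) • ContinuousLinearMap.id ℝ ℂ : ℂ →L[ℝ] ℂ) := by
  refine hasMFDerivAt_upperHalfPlane ?_
  have hden : (g 1 0 : ℂ) * z + g 1 1 ≠ 0 := UpperHalfPlane.denom_ne_zero (g : GL (Fin 2) ℝ) z
  have hdet : (g 0 0 : ℂ) * g 1 1 - g 0 1 * g 1 0 = 1 := by
    have := g.2
    rw [Matrix.det_fin_two] at this
    exact_mod_cast this
  have h1 : HasDerivAt (fun w : ℂ => ((g 0 0 : ℂ) * w + g 0 1) / ((g 1 0 : ℂ) * w + g 1 1))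
      (1 / ((g 1 0 : ℂ) * z + g 1 1) ^ 2) z := by
    refine ((((hasDerivAt_id (z : ℂ)).const_mul _).add_const _).div
      (((hasDerivAt_id (z : ℂ)).const_mul _).add_const _) hden).congr_deriv ?_
    congr 1
    simp only [id_eq]
    linear_combination hdet
  have h2 : HasMFDerivAt 𝓘(ℝ, ℂ) 𝓘(ℝ, ℂ)
      (fun w : ℂ => ((g 0 0 : ℂ) * w + g 0 1) / ((g 1 0 : ℂ) * w + g 1 1)) (z : ℂ) _ :=
    (h1.hasFDerivAt.restrictScalars ℝ).hasMFDerivAt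
  have h3 := HasMFDerivAt.comp z h2 (hasMFDerivAt_upperHalfPlane_coe z)
  have h4 : (fun w : ℍ => ((g • w : ℍ) : ℂ)) =
      (fun w : ℂ => ((g 0 0 : ℂ) * w + g 0 1) / ((g 1 0 : ℂ) * w + g 1 1)) ∘ UpperHalfPlane.coe := by
    funext w
    rw [UpperHalfPlane.coe_specialLinearGroup_apply]
    rfl
  rw [h4]
  have h5 : ((1 / ((g 1 0 : ℂ) * z + g 1 1) ^ 2) • ContinuousLinearMap.id ℝ ℂ) =
      (ContinuousLinearMap.toSpanSingleton ℂ
        (1 / ((g 1 0 : ℂ) * z + g 1 1) ^ 2)).restrictScalars ℝ ∘L ContinuousLinearMap.id ℝ ℂ := by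
    refine ContinuousLinearMap.ext fun w => ?_
    simp [mul_comm]
  exact h3.congr_mfderiv h5.symm

/-- The differential is multiplication by `(cz + d)⁻²`, which scales Euclidean area by `|cz + d|⁻⁴`.
The imaginary part is divided by `|cz + d|²`, so the density `1 / y²` absorbs the factor exactly. -/
theorem pullback_smul_hyperbolicAreaForm (g : SL(2, ℝ)) :
    hyperbolicAreaForm.pullback (I := 𝓘(ℝ, ℂ)) (fun w : ℍ => g • w) = hyperbolicAreaForm := by
  funext z
  refine ContinuousAlternatingMap.ext fun v => ?_
  change Fin 2 → ℂ at v
  rw [DiffForm.pullback_apply_of_hasMFDerivAt (hasMFDerivAt_smul_upperHalfPlane g z)]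
  refine (hyperbolicAreaForm_apply _ _).trans ((hyperbolicAreaForm_apply _ _).trans ?_).symm
  have hden : (g 1 0 : ℂ) * z + g 1 1 ≠ 0 := UpperHalfPlane.denom_ne_zero (g : GL (Fin 2) ℝ) z
  have him : (g • z : ℍ).im = z.im / Complex.normSq ((g 1 0 : ℂ) * z + g 1 1) :=
    by
    simpa using! z.im_smul_eq_div_normSq (g : GL (Fin 2) ℝ)
  rw [him]
  have hmul : ∀ l a b : ℂ, (l * a).re * (l * b).im - (l * b).re * (l * a).im =
      Complex.normSq l * (a.re * b.im - b.re * a.im) := fun l a b => by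
    simp [Complex.normSq_apply]; ring
  simp only [smul_apply, ContinuousLinearMap.id_apply, smul_eq_mul]
  rw [hmul]
  have hn : Complex.normSq ((g 1 0 : ℂ) * z + g 1 1) ≠ 0 := by simpa using hden
  have hz := z.im_pos.ne'
  simp only [map_div₀, map_pow, map_one]
  field_simp

variable {Γ : Type*} [Group Γ] (ρ : Γ →* PSL(2, ℝ))

theorem FuchsianSurface.exists_deck {z z' : ℍ}
    (h : (Quotient.mk _ z : FuchsianSurface ρ) = Quotient.mk _ z') :
    ∃ g : SL(2, ℝ), g • z = z' ∧
      ∀ w : ℍ, (Quotient.mk _ (g • w) : FuchsianSurface ρ) = Quotient.mk _ w := by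
  obtain ⟨⟨γ, hγ⟩, h2⟩ := Quotient.exact h.symm
  obtain ⟨g, rfl⟩ := QuotientGroup.mk_surjective γ
  exact ⟨g, h2, fun w => Quotient.sound ⟨⟨_, hγ⟩, rfl⟩⟩

variable [IsFuchsian ρ]

theorem FuchsianSurface.isQuotientCharted :
    IsQuotientCharted (E := ℂ) (Quotient.mk (MulAction.orbitRel ρ.range ℍ))
      (Function.surjInv Quotient.mk_surjective) :=
  (FuchsianSurface.isLocalHomeomorph_mk ρ).isQuotientCharted _

theorem FuchsianSurface.mdifferentiableAt_mk (z : ℍ) :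
    MDifferentiableAt 𝓘(ℝ, ℂ) 𝓘(ℝ, ℂ) (Quotient.mk (MulAction.orbitRel ρ.range ℍ)) z := by
  obtain ⟨g, h1, h2⟩ := FuchsianSurface.exists_deck ρ
    (FuchsianSurface.isQuotientCharted ρ (Quotient.mk _ z)).1.symm
  exact ((FuchsianSurface.isQuotientCharted ρ).hasMFDerivAt h1 h2
    (hasMFDerivAt_smul_upperHalfPlane g z)).mdifferentiableAt

/-- The area form of the surface is a choice among forms with this property, so it is enough that
one exists; Möbius invariance lets the form of the half plane descend. -/
theorem pullback_surfaceAreaForm :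
    (surfaceAreaForm ρ).pullback (Quotient.mk (MulAction.orbitRel ρ.range ℍ)) =
      hyperbolicAreaForm := by
  refine Classical.epsilon_spec (p := fun η : DiffForm 𝓘(ℝ, ℂ) (FuchsianSurface ρ) 2 =>
    η.pullback (Quotient.mk (MulAction.orbitRel ρ.range ℍ)) = hyperbolicAreaForm) ?_
  refine (FuchsianSurface.isQuotientCharted ρ).exists_pullback_eq _ fun z z' h => ?_
  obtain ⟨g, h1, h2⟩ := FuchsianSurface.exists_deck ρ h
  exact ⟨fun w => g • w, h1, h2, (hasMFDerivAt_smul_upperHalfPlane g z).mdifferentiableAt,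
    congrFun (pullback_smul_hyperbolicAreaForm g) z⟩

end HyperbolicPlane

/-! ### Anti-de Sitter space as a quadric of matrices: metric, connection, geodesic equation -/

section Geodesics

/-- The polarisation of the determinant. -/
def polarDet (A B : Matrix (Fin 2) (Fin 2) ℝ) : ℝ :=
  A 0 0 * B 1 1 + A 1 1 * B 0 0 - A 0 1 * B 1 0 - A 1 0 * B 0 1

theorem polarDet_comm (A B : Matrix (Fin 2) (Fin 2) ℝ) : polarDet A B = polarDet B A := by
  unfold polarDet; ring

theorem polarDet_self (A : Matrix (Fin 2) (Fin 2) ℝ) : polarDet A A = 2 * A.det := by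
  rw [Matrix.det_fin_two, polarDet]; ring

theorem polarDet_add_left (A B C : Matrix (Fin 2) (Fin 2) ℝ) :
    polarDet (A + B) C = polarDet A C + polarDet B C := by
  simp [polarDet]; ring

theorem polarDet_smul_left (a : ℝ) (A C : Matrix (Fin 2) (Fin 2) ℝ) :
    polarDet (a • A) C = a * polarDet A C := by
  simp [polarDet]; ring

theorem polarDet_add_right (A B C : Matrix (Fin 2) (Fin 2) ℝ) :
    polarDet A (B + C) = polarDet A B + polarDet A C := by
  simp [polarDet]; ring

theorem polarDet_smul_right (a : ℝ) (A C : Matrix (Fin 2) (Fin 2) ℝ) :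
    polarDet A (a • C) = a * polarDet A C := by
  simp [polarDet]; ring

/-- As `polarDet A A = 2 det A`, the metric is the restriction of `-det`. This allows all Riemannian
notions to be computed in the flat ambient space of matrices. -/
theorem adsMetric_eq_polarDet (x v w : AdS) :
    adsMetric x v w = -(1 / 2) * polarDet (slCoverDeriv x v) (slCoverDeriv x w) :=
  adsMetric_eq_det x v w

/-- This is the derivative of `det = 1`: the position matrix is normal to the quadric. -/
theorem polarDet_slCoverDeriv_slCover (x v : AdS) :
    polarDet (slCoverDeriv x v) (slCover x).val = 0 := by
  rw [polarDet]
  linear_combination slCoverDeriv_det x v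

/-- The determinant form is nondegenerate, and matrices split into the tangent and the normal space
of the special linear group. -/
theorem eq_zero_of_polarDet_eq_zero (x : AdS) (A : Matrix (Fin 2) (Fin 2) ℝ)
    (h : polarDet A (slCover x).val = 0) (h' : ∀ v, polarDet A (slCoverDeriv x v) = 0) :
    A = 0 := by
  have hr := adsRadius_sq x
  have hp := (adsRadius_pos x).ne'
  have hs := Real.sin_sq_add_cos_sq x.2
  -- The three coordinate vectors span the tangent space.
  have h1 := h' (1, 0)
  have h2 := h' (Complex.I, 0)
  have h3 := h' (0, 1)
  simp only [polarDet, slCoverDeriv_eq, adsRadius_fderiv', slCover, Matrix.of_apply,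
    Matrix.cons_val', Matrix.cons_val_zero, Matrix.cons_val_one, Matrix.cons_val_fin_one,
    Complex.one_re, Complex.one_im, Complex.I_re, Complex.I_im, Complex.zero_re, Complex.zero_im]
    at h h1 h2 h3
  generalize adsRadius x = r at *
  generalize Real.cos x.2 = c at *
  generalize Real.sin x.2 = s at *
  field_simp at h1 h2
  have e1 : (A 0 0 + A 1 1) * s = (A 0 1 - A 1 0) * c := by
    apply mul_left_cancel₀ hp
    linear_combination -h3
  -- By `e1` the conformal part of `A` is parallel to `(cos, sin)`, with coefficient `k`. Together
  -- with `h1` and `h2` this says that `A` is `k / (2r)` times the position matrix, which has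
  -- determinant one; orthogonality to the position then forces `k = 0`.
  set k := (A 0 0 + A 1 1) * c + (A 0 1 - A 1 0) * s with hk
  have e2 : A 0 0 + A 1 1 = k * c := by rw [hk]; linear_combination (-(A 0 0 + A 1 1)) * hs + s * e1
  have e3 : A 0 1 - A 1 0 = k * s := by rw [hk]; linear_combination (-(A 0 1 - A 1 0)) * hs - c * e1
  have e4 : r * (A 0 0 - A 1 1) = k * x.1.re := by
    rw [hk]; linear_combination -h1
  have e5 : r * (A 0 1 + A 1 0) = k * x.1.im := by
    rw [hk]; linear_combination -h2
  have e6 : k = 0 := by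
    linear_combination (-k) * hr + r * h + x.1.re * e4 + x.1.im * e5
  rw [e6] at e2 e3 e4 e5
  have e7 : A 0 0 - A 1 1 = 0 := by simpa [hp] using e4
  have e8 : A 0 1 + A 1 0 = 0 := by simpa [hp] using e5
  ext i j
  fin_cases i <;> fin_cases j <;> simp <;> linarith

/-- The traceless symmetric part of the image is `v.1`. Once it vanishes, the component of the rest
along `(-sin, cos)` is `adsRadius x * v.2`. -/
theorem slCoverDeriv_injective (x v : AdS) (h : slCoverDeriv x v = 0) : v = 0 := by
  rw [slCoverDeriv_eq] at h
  have h00 := congrFun (congrFun h 0) 0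
  have h01 := congrFun (congrFun h 0) 1
  have h10 := congrFun (congrFun h 1) 0
  have h11 := congrFun (congrFun h 1) 1
  simp only [Matrix.of_apply, Matrix.cons_val', Matrix.cons_val_zero, Matrix.cons_val_one,
    Matrix.cons_val_fin_one, Matrix.zero_apply] at h00 h01 h10 h11
  have e1 : v.1.re = 0 := by linarith
  have e2 : v.1.im = 0 := by linarith
  have e3 : adsRadius x * v.2 = 0 := by
    have hs := Real.sin_sq_add_cos_sq x.2
    linear_combination (-(adsRadius x * v.2)) * hs - Real.sin x.2 * h00 + Real.cos x.2 * h01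
      + Real.sin x.2 * e1 - Real.cos x.2 * e2
  have e4 : v.2 = 0 := by simpa [(adsRadius_pos x).ne'] using e3
  exact Prod.ext (Complex.ext e1 e2) e4

/-- A tangent vector is already orthogonal to the position; if it is orthogonal to all tangent
vectors too, its matrix vanishes by nondegeneracy of the ambient form. -/
theorem adsMetric_nondegenerate (x v : AdS) (h : ∀ z, adsMetric x v z = 0) : v = 0 := by
  refine slCoverDeriv_injective x v (eq_zero_of_polarDet_eq_zero x _
    (polarDet_slCoverDeriv_slCover x v) fun z => ?_)
  have := h z
  rw [adsMetric_eq_polarDet] at this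
  linarith

/-- The second derivative of the covering map, with values in `2 × 2` matrices. -/
noncomputable def slCoverHess (x v w : AdS) : Matrix (Fin 2) (Fin 2) ℝ :=
  Matrix.of fun i j => fderiv ℝ (fderiv ℝ (fun y => slCover y i j)) x v w

theorem slCoverHess_comm (x v w : AdS) : slCoverHess x v w = slCoverHess x w v := by
  ext i j
  exact ((contDiff_slCover i j).contDiffAt.isSymmSndFDerivAt (by simpa using! WithTop.coe_le_coe.mpr (le_top : (2 : ℕ∞) ≤ ⊤))).eq v w

theorem hasFDerivAt_slCover (i j : Fin 2) (x : AdS) :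
    HasFDerivAt (fun y => slCover y i j) (fderiv ℝ (fun y => slCover y i j) x) x :=
  (differentiable_slCover i j x).hasFDerivAt

theorem hasFDerivAt_fderiv_slCover (i j : Fin 2) (x : AdS) :
    HasFDerivAt (fderiv ℝ (fun y => slCover y i j))
      (fderiv ℝ (fderiv ℝ (fun y => slCover y i j)) x) x :=
  (((contDiff_slCover i j).fderiv_right (m := ∞) (by simp)).differentiable
    (by simp) x).hasFDerivAt

theorem fderiv_adsMetric (x v w z : AdS) : fderiv ℝ (fun y => adsMetric y w z) x v =
    -(1 / 2) * (polarDet (slCoverHess x v w) (slCoverDeriv x z)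
      + polarDet (slCoverDeriv x w) (slCoverHess x v z)) := by
  have h : ∀ (u : AdS) i j, HasFDerivAt (fun y => slCoverDeriv y u i j)
      ((fderiv ℝ (fderiv ℝ (fun y => slCover y i j)) x).flip u) x := fun u i j =>
    ((hasFDerivAt_fderiv_slCover i j x).clm_apply (hasFDerivAt_const u x)).congr_fderiv
      (by ext <;> simp)
  have h2 := ((((h w 0 0).mul (h z 1 1)).add ((h w 1 1).mul (h z 0 0))).sub
    ((h w 0 1).mul (h z 1 0))).sub ((h w 1 0).mul (h z 0 1))
  have h3 := (h2.const_mul (-(1 / 2))).congr_of_eventuallyEq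
    (Filter.Eventually.of_forall fun y => adsMetric_eq_det y w z)
  rw [h3.fderiv]
  simp [polarDet, slCoverHess]
  ring

/-- This gives content to the choice made in `christoffel`. The solution is the tangential part of
the second derivative of the covering map: of the six terms of the Koszul sum, four cancel by
symmetry of the Hessian and the other two coincide. -/
theorem exists_christoffel (x : AdS) : ∃ G : AdS →ₗ[ℝ] AdS →ₗ[ℝ] AdS, ∀ v w z : AdS,
    2 * adsMetric x (G v w) z = fderiv ℝ (fun y => adsMetric y w z) x v
      + fderiv ℝ (fun y => adsMetric y v z) x w - fderiv ℝ (fun y => adsMetric y v w) x z := by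
  have hinj : Function.Injective (adsMetric x : AdS →ₗ[ℝ] Module.Dual ℝ AdS) := by
    rw [← LinearMap.ker_eq_bot, LinearMap.ker_eq_bot']
    exact fun v hv => adsMetric_nondegenerate x v fun z => DFunLike.congr_fun hv z
  let e : AdS ≃ₗ[ℝ] Module.Dual ℝ AdS := LinearEquiv.ofInjectiveOfFinrankEq (adsMetric x) hinj
    (Subspace.dual_finrank_eq).symm
  have he : ∀ φ z, adsMetric x (e.symm φ) z = φ z := fun φ z =>
    DFunLike.congr_fun (e.apply_symm_apply φ) z
  -- The metric pairing of the ambient vector `slCoverHess x v w` with tangent vectors; `e.symm`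
  -- turns it into the tangent vector that represents it.
  let K : AdS → AdS → Module.Dual ℝ AdS := fun v w =>
    { toFun := fun z => -(1 / 2) * polarDet (slCoverHess x v w) (slCoverDeriv x z)
      map_add' := fun z z' => by rw [map_add, polarDet_add_right]; ring
      map_smul' := fun a z => by rw [map_smul, polarDet_smul_right]; simp; ring }
  refine ⟨LinearMap.mk₂ ℝ (fun v w => e.symm (K v w)) ?_ ?_ ?_ ?_, fun v w z => ?_⟩
  · intro v v' w
    rw [← map_add]
    congr 1
    refine LinearMap.ext fun z => ?_
    simp [K, polarDet, slCoverHess]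
    ring
  · intro a v w
    rw [← map_smul]
    congr 1
    refine LinearMap.ext fun z => ?_
    simp [K, polarDet, slCoverHess]
    ring
  · intro v w w'
    rw [← map_add]
    congr 1
    refine LinearMap.ext fun z => ?_
    simp [K, polarDet, slCoverHess]
    ring
  · intro a v w
    rw [← map_smul]
    congr 1
    refine LinearMap.ext fun z => ?_
    simp [K, polarDet, slCoverHess]
    ring
  · rw [LinearMap.mk₂_apply, he, fderiv_adsMetric, fderiv_adsMetric, fderiv_adsMetric,
      slCoverHess_comm x w v, slCoverHess_comm x z v, slCoverHess_comm x z w,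
      polarDet_comm (slCoverDeriv x w), polarDet_comm (slCoverDeriv x v)]
    change 2 * (-(1 / 2) * polarDet (slCoverHess x v w) (slCoverDeriv x z)) = _
    ring

/-- The Gauss formula: the Levi-Civita connection is the tangential part of the flat connection. -/
theorem polarDet_slCoverDeriv_christoffel (x v w z : AdS) :
    polarDet (slCoverDeriv x (christoffel x v w)) (slCoverDeriv x z) =
      polarDet (slCoverHess x v w) (slCoverDeriv x z) := by
  have h := Classical.epsilon_spec (exists_christoffel x) v w z
  change 2 * adsMetric x (christoffel x v w) z = _ at h
  rw [adsMetric_eq_polarDet, fderiv_adsMetric, fderiv_adsMetric, fderiv_adsMetric,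
    slCoverHess_comm x w v, slCoverHess_comm x z v, slCoverHess_comm x z w,
    polarDet_comm (slCoverDeriv x w), polarDet_comm (slCoverDeriv x v)] at h
  linear_combination -h

variable {c : ℝ → AdS}

theorem hasDerivAt_slCover_comp (hc : ContDiff ℝ ∞ c) (i j : Fin 2) (t : ℝ) :
    HasDerivAt (fun t => slCover (c t) i j) (slCoverDeriv (c t) (deriv c t) i j) t :=
  (hasFDerivAt_slCover i j (c t)).comp_hasDerivAt t (hc.differentiable (by simp) t).hasDerivAt

theorem hasDerivAt_slCoverDeriv_comp (hc : ContDiff ℝ ∞ c) (i j : Fin 2) (t : ℝ) :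
    HasDerivAt (fun t => slCoverDeriv (c t) (deriv c t) i j)
      ((slCoverHess (c t) (deriv c t) (deriv c t)
        + slCoverDeriv (c t) (deriv (deriv c) t)) i j) t := by
  have hc' : ContDiff ℝ ∞ (deriv c) := (contDiff_infty_iff_deriv.mp hc).2
  exact ((hasFDerivAt_fderiv_slCover i j (c t)).comp_hasDerivAt t
    (hc.differentiable (by simp) t).hasDerivAt).clm_apply
      (hc'.differentiable (by simp) t).hasDerivAt

/-- A curve is a geodesic if and only if its second derivative as a curve of matrices is normal. -/
theorem isGeodesic_iff (hc : ContDiff ℝ ∞ c) : IsGeodesic c ↔ ∀ t z,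
    polarDet (slCoverHess (c t) (deriv c t) (deriv c t)
        + slCoverDeriv (c t) (deriv (deriv c) t)) (slCoverDeriv (c t) z) = 0 := by
  have key : ∀ t z, adsMetric (c t) (deriv (deriv c) t
      + christoffel (c t) (deriv c t) (deriv c t)) z =
      -(1 / 2) * polarDet (slCoverHess (c t) (deriv c t) (deriv c t)
        + slCoverDeriv (c t) (deriv (deriv c) t)) (slCoverDeriv (c t) z) := fun t z => by
    rw [adsMetric_eq_polarDet, map_add, polarDet_add_left, polarDet_add_left,
      polarDet_slCoverDeriv_christoffel]
    ring
  refine ⟨fun h t z => ?_, fun h => ⟨hc, fun t => ?_⟩⟩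
  · have := key t z
    rw [h.2 t] at this
    simpa using this
  · refine adsMetric_nondegenerate (c t) _ fun z => ?_
    rw [key, h t z, mul_zero]

end Geodesics

/-! ### Explicit unit timelike geodesics and the generator of the flow -/

section UnitGeodesics

/-- A solution of `f'' = -f`. -/
theorem eq_cos_add_sin {f f' : ℝ → ℝ} (h : ∀ t, HasDerivAt f (f' t) t)
    (h' : ∀ t, HasDerivAt f' (-f t) t) (t : ℝ) :
    f t = Real.cos t * f 0 + Real.sin t * f' 0 := by
  -- The pair `(f, f')` turns at unit speed, so rotating it back by the angle `t` gives a constant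
  -- vector; `h1` and `h2` are its two components.
  have h1 : ∀ t, HasDerivAt (fun t => Real.cos t * f t - Real.sin t * f' t) 0 t := fun t =>
    (((Real.hasDerivAt_cos t).mul (h t)).sub ((Real.hasDerivAt_sin t).mul (h' t))).congr_deriv
      (by ring)
  have h2 : ∀ t, HasDerivAt (fun t => Real.sin t * f t + Real.cos t * f' t) 0 t := fun t =>
    (((Real.hasDerivAt_sin t).mul (h t)).add ((Real.hasDerivAt_cos t).mul (h' t))).congr_deriv
      (by ring)
  have e1 := is_const_of_deriv_eq_zero (fun t => (h1 t).differentiableAt)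
    (fun t => (h1 t).deriv) t 0
  have e2 := is_const_of_deriv_eq_zero (fun t => (h2 t).differentiableAt)
    (fun t => (h2 t).deriv) t 0
  simp only [Real.cos_zero, Real.sin_zero, one_mul, zero_mul, sub_zero, zero_add] at e1 e2
  linear_combination Real.cos t * e1 + Real.sin t * e2 - f t * Real.sin_sq_add_cos_sq t

theorem det_slCoverDeriv {m : AdS × AdS} (hm : m ∈ UnitFutureTangent) :
    (slCoverDeriv m.1 m.2).det = 1 := by
  have h1 : adsMetric m.1 m.2 m.2 = -1 := hm.1
  rw [adsMetric_eq_polarDet, polarDet_self] at h1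
  linarith

theorem hasDerivAt_polarDet {f g : ℝ → Matrix (Fin 2) (Fin 2) ℝ} {f' g' : Matrix (Fin 2) (Fin 2) ℝ}
    {t : ℝ} (hf : ∀ i j, HasDerivAt (fun t => f t i j) (f' i j) t)
    (hg : ∀ i j, HasDerivAt (fun t => g t i j) (g' i j) t) :
    HasDerivAt (fun t => polarDet (f t) (g t)) (polarDet f' (g t) + polarDet (f t) g') t :=
  (((((hf 0 0).mul (hg 1 1)).add ((hf 1 1).mul (hg 0 0))).sub ((hf 0 1).mul (hg 1 0))).sub
    ((hf 1 0).mul (hg 0 1))).congr_deriv (by simp only [polarDet]; ring)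

/-- A unit timelike geodesic is a trigonometric curve of matrices. -/
theorem IsGeodesic.slCover_eq {c : ℝ → AdS} (hc : IsGeodesic c)
    (hm : (c 0, deriv c 0) ∈ UnitFutureTangent) (t : ℝ) :
    (slCover (c t)).val = Real.cos t • (slCover (c 0)).val
      + Real.sin t • slCoverDeriv (c 0) (deriv c 0) := by
  have hg := (isGeodesic_iff hc.1).mp hc
  obtain ⟨f2, hf2⟩ : ∃ f2 : ℝ → Matrix (Fin 2) (Fin 2) ℝ, ∀ t, slCoverHess (c t) (deriv c t)
    (deriv c t) + slCoverDeriv (c t) (deriv (deriv c) t) = f2 t := ⟨_, fun t => rfl⟩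
  have d1 : ∀ t i j, HasDerivAt (fun t => (slCover (c t)).val i j)
    (slCoverDeriv (c t) (deriv c t) i j) t := fun t i j => hasDerivAt_slCover_comp hc.1 i j t
  have d2 : ∀ t i j, HasDerivAt (fun t => slCoverDeriv (c t) (deriv c t) i j) (f2 t i j) t :=
    fun t i j => hf2 t ▸ hasDerivAt_slCoverDeriv_comp hc.1 i j t
  replace hg : ∀ t z, polarDet (f2 t) (slCoverDeriv (c t) z) = 0 := fun t z => hf2 t ▸ hg t z
  -- Constancy of speed: the acceleration `f2` is orthogonal to the velocity.
  have n1 : ∀ t, polarDet (slCoverDeriv (c t) (deriv c t)) (slCoverDeriv (c t) (deriv c t)) = 2 := by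
    intro t
    have h : ∀ t, HasDerivAt (fun t => polarDet (slCoverDeriv (c t) (deriv c t))
        (slCoverDeriv (c t) (deriv c t))) 0 t := fun t =>
      (hasDerivAt_polarDet (d2 t) (d2 t)).congr_deriv (by
        rw [polarDet_comm _ (f2 t), hg, add_zero])
    rw [is_const_of_deriv_eq_zero (fun t => (h t).differentiableAt) (fun t => (h t).deriv) t 0,
      polarDet_self, det_slCoverDeriv hm, mul_one]
  -- Differentiating the orthogonality of velocity and position gives `polarDet (f2) (position) +
  -- polarDet (velocity) (velocity) = 0`.
  have n2 : ∀ t, polarDet (f2 t) (slCover (c t)).val = -2 := by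
    intro t
    have h := (hasDerivAt_polarDet (f := fun t => slCoverDeriv (c t) (deriv c t))
      (g := fun t => (slCover (c t)).val) (d2 t) (d1 t)).congr_of_eventuallyEq
      (Filter.Eventually.of_forall fun s => (polarDet_slCoverDeriv_slCover (c s) (deriv c s)).symm)
    have h2 := h.unique (hasDerivAt_const t 0)
    rw [n1] at h2
    linarith
  -- The sum of acceleration and position is orthogonal to the position by `n2` and to every tangent
  -- vector by the geodesic equation, so each matrix entry solves the harmonic oscillator equation.
  have n3 : ∀ t, f2 t = -(slCover (c t)).val := by
    intro t
    rw [← sub_eq_zero, sub_neg_eq_add]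
    refine eq_zero_of_polarDet_eq_zero (c t) _ ?_ fun z => ?_
    · rw [polarDet_add_left, n2, polarDet_self, (slCover (c t)).2]; norm_num
    · rw [polarDet_add_left, hg, polarDet_comm _ (slCoverDeriv _ _), polarDet_slCoverDeriv_slCover,
        add_zero]
  ext i j
  simp only [n3] at d2
  exact eq_cos_add_sin (fun t => d1 t i j) (fun t => d2 t i j) t

/-- A nowhere vanishing smooth plane curve has a smooth logarithm. -/
theorem exists_contDiff_log {z : ℝ → ℂ} (hz : ContDiff ℝ ∞ z) (h0 : ∀ t, z t ≠ 0) :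
    ∃ ζ : ℝ → ℂ, ContDiff ℝ ∞ ζ ∧ ζ 0 = 0 ∧ ∀ t, z t = z 0 * Complex.exp (ζ t) := by
  have hz' : ContDiff ℝ ∞ (deriv z) := (contDiff_infty_iff_deriv.mp hz).2
  have hq : ContDiff ℝ ∞ fun t => deriv z t / z t := by
    simp only [div_eq_mul_inv]
    exact hz'.mul (hz.inv h0)
  have hd : ∀ t, HasDerivAt (fun t => ∫ s in (0 : ℝ)..t, deriv z s / z s) (deriv z t / z t) t :=
    fun t => intervalIntegral.integral_hasDerivAt_right
      (hq.continuous.intervalIntegrable _ _)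
      (hq.continuous.stronglyMeasurableAtFilter _ _) hq.continuous.continuousAt
  -- With `ζ` the integral of the logarithmic derivative, `z * exp (-ζ)` has zero derivative.
  refine ⟨fun t => ∫ s in (0 : ℝ)..t, deriv z s / z s, ?_, by simp, fun t => ?_⟩
  · refine contDiff_infty_iff_deriv.mpr ⟨fun t => (hd t).differentiableAt, ?_⟩
    rwa [show deriv (fun t => ∫ s in (0 : ℝ)..t, deriv z s / z s) = fun t => deriv z t / z t from
      funext fun t => (hd t).deriv]
  · have h : ∀ t, HasDerivAt (fun t => z t * Complex.exp (-∫ s in (0 : ℝ)..t, deriv z s / z s)) 0 t :=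
      fun t => ((hz.differentiable (by simp) t).hasDerivAt.mul (hd t).neg.cexp).congr_deriv (by
        have := h0 t
        field_simp
        ring)
    have e := is_const_of_deriv_eq_zero (fun t => (h t).differentiableAt)
      (fun t => (h t).deriv) t 0
    simp only [intervalIntegral.integral_same, neg_zero, Complex.exp_zero, mul_one,
      Complex.exp_neg] at e
    rw [← e]
    field_simp [Complex.exp_ne_zero]

/-- A smooth curve in `SL(2, ℝ)` lifts to the universal cover. -/
theorem exists_lift {f : ℝ → Matrix (Fin 2) (Fin 2) ℝ} (hf : ∀ i j, ContDiff ℝ ∞ fun t => f t i j)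
    (hdet : ∀ t, (f t).det = 1) {x : AdS} (hx : f 0 = (slCover x).val) :
    ∃ c : ℝ → AdS, ContDiff ℝ ∞ c ∧ c 0 = x ∧ ∀ t, (slCover (c t)).val = f t := by
  -- These invert the parametrisation `slCover`: `β` is the traceless symmetric part and `z`, below,
  -- the conformal part `a + bi`. As the determinant is `|z|² - |β|²`, the curve `z` avoids zero,
  -- and its logarithm provides a continuous argument, hence the coordinate `φ`.
  set β : ℝ → ℂ := fun t => ((f t 0 0 - f t 1 1) / 2 : ℝ) + ((f t 0 1 + f t 1 0) / 2 : ℝ) * Complex.I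
    with hβ
  set z : ℝ → ℂ := fun t => ((f t 0 0 + f t 1 1) / 2 : ℝ) + ((f t 0 1 - f t 1 0) / 2 : ℝ) * Complex.I
    with hz
  have h00 := hf 0 0
  have h01 := hf 0 1
  have h10 := hf 1 0
  have h11 := hf 1 1
  have hofReal : ∀ g : ℝ → ℝ, ContDiff ℝ ∞ g → ContDiff ℝ ∞ fun t => (g t : ℂ) := fun g hg =>
    Complex.ofRealCLM.contDiff.comp hg
  have hβc : ContDiff ℝ ∞ β := by
    refine (hofReal _ ?_).add ((hofReal _ ?_).mul contDiff_const) <;> fun_prop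
  have hzc : ContDiff ℝ ∞ z := by
    refine (hofReal _ ?_).add ((hofReal _ ?_).mul contDiff_const) <;> fun_prop
  have βre : ∀ t, (β t).re = (f t 0 0 - f t 1 1) / 2 := fun t => by simp [hβ]
  have βim : ∀ t, (β t).im = (f t 0 1 + f t 1 0) / 2 := fun t => by simp [hβ]
  have zre : ∀ t, (z t).re = (f t 0 0 + f t 1 1) / 2 := fun t => by simp [hz]
  have zim : ∀ t, (z t).im = (f t 0 1 - f t 1 0) / 2 := fun t => by simp [hz]
  have hnorm : ∀ t, ‖z t‖ ^ 2 = 1 + (β t).re ^ 2 + (β t).im ^ 2 := fun t => by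
    have := hdet t
    rw [Matrix.det_fin_two] at this
    rw [← Complex.normSq_eq_norm_sq, Complex.normSq_apply, zre, zim, βre, βim]
    linear_combination this
  have hz0 : ∀ t, z t ≠ 0 := fun t h => by
    have := hnorm t
    rw [h] at this
    simp at this
    nlinarith [sq_nonneg (β t).re, sq_nonneg (β t).im]
  obtain ⟨ζ, hζ, hζ0, hexp⟩ := exists_contDiff_log hzc hz0
  have hβ0 : β 0 = x.1 := by
    apply Complex.ext
    · rw [βre, hx]; simp [slCover]
    · rw [βim, hx]; simp [slCover]; ring
  have hzr : z 0 = adsRadius x * Complex.exp (x.2 * Complex.I) := by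
    apply Complex.ext
    · rw [zre, hx]; simp [slCover, Complex.exp_ofReal_mul_I_re]
    · rw [zim, hx]; simp [slCover, Complex.exp_ofReal_mul_I_im]
  have hcov : ∀ t, (slCover (β t, x.2 + (ζ t).im)).val = f t := by
    intro t
    have hr : adsRadius (β t, x.2 + (ζ t).im) = ‖z t‖ := by
      rw [adsRadius, ← hnorm, Real.sqrt_sq (norm_nonneg _)]
    have hp : z t = ‖z t‖ * Complex.exp ((x.2 + (ζ t).im : ℝ) * Complex.I) := by
      have hn : ‖z t‖ = adsRadius x * Real.exp (ζ t).re := by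
        rw [hexp, hzr, norm_mul, norm_mul, Complex.norm_exp, Complex.norm_exp]
        simp [abs_of_pos (adsRadius_pos x)]
      rw [hn, hexp t, hzr]
      push_cast
      rw [mul_assoc, mul_assoc, ← Complex.exp_add, ← Complex.exp_add]
      congr 2
      nth_rw 1 [← Complex.re_add_im (ζ t)]
      ring
    have e1 := zre t
    have e2 := zim t
    rw [hp, Complex.re_ofReal_mul, Complex.exp_ofReal_mul_I_re] at e1
    rw [hp, Complex.im_ofReal_mul, Complex.exp_ofReal_mul_I_im] at e2
    have e3 := βre t
    have e4 := βim t
    ext i j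
    fin_cases i <;> fin_cases j <;> simp [slCover, hr] <;> linarith
  refine ⟨fun t => (β t, x.2 + (ζ t).im), ?_, ?_, hcov⟩
  · exact hβc.prodMk (contDiff_const.add (Complex.imCLM.contDiff.comp hζ))
  · simp [hβ0, hζ0]

/-- Position and velocity both have determinant one and are orthogonal, so `cos t • g + sin t • N`
stays in the quadric and lifts to the cover. Its second derivative is minus itself, which is normal.
-/
theorem exists_isGeodesic {m : AdS × AdS} (hm : m ∈ UnitFutureTangent) :
    ∃ c, IsGeodesic c ∧ c 0 = m.1 ∧ deriv c 0 = m.2 := by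
  set f : ℝ → Matrix (Fin 2) (Fin 2) ℝ := fun t =>
    Real.cos t • (slCover m.1).val + Real.sin t • slCoverDeriv m.1 m.2 with hf
  set f' : ℝ → Matrix (Fin 2) (Fin 2) ℝ := fun t =>
    -Real.sin t • (slCover m.1).val + Real.cos t • slCoverDeriv m.1 m.2 with hf'
  have hff' : ∀ t i j, HasDerivAt (fun t => f t i j) (f' t i j) t := fun t i j =>
    ((Real.hasDerivAt_cos t).mul_const _).add ((Real.hasDerivAt_sin t).mul_const _)
  have hf'f : ∀ t i j, HasDerivAt (fun t => f' t i j) ((-f t) i j) t := fun t i j =>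
    (((Real.hasDerivAt_sin t).neg.mul_const _).add
      ((Real.hasDerivAt_cos t).mul_const _)).congr_deriv (by simp [hf]; ring)
  have hdet : ∀ t, (f t).det = 1 := fun t => by
    have h1 := polarDet_self (f t)
    have h2 := polarDet_slCoverDeriv_slCover m.1 m.2
    have h3 := polarDet_self (slCover m.1).val
    have h4 := polarDet_self (slCoverDeriv m.1 m.2)
    rw [det_slCoverDeriv hm] at h4
    rw [(slCover m.1).2] at h3
    simp only [hf, polarDet_add_left, polarDet_add_right, polarDet_smul_left,
      polarDet_smul_right, h3, h4, polarDet_comm (slCover m.1).val, h2] at h1 ⊢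
    linear_combination -h1 / 2 + Real.sin_sq_add_cos_sq t
  have hcont : ∀ i j, ContDiff ℝ ∞ fun t => f t i j := fun i j =>
    (Real.contDiff_cos.mul contDiff_const).add (Real.contDiff_sin.mul contDiff_const)
  obtain ⟨c, hc, hc0, hcf⟩ := exists_lift hcont hdet (x := m.1) (by simp [hf])
  have e1 : ∀ t, slCoverDeriv (c t) (deriv c t) = f' t := fun t => by
    ext i j
    refine (hasDerivAt_slCover_comp hc i j t).unique ((hff' t i j).congr_of_eventuallyEq ?_)
    exact Filter.Eventually.of_forall fun s => congrFun (congrFun (hcf s) i) j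
  have e2 : ∀ t, slCoverHess (c t) (deriv c t) (deriv c t) + slCoverDeriv (c t) (deriv (deriv c) t)
      = -(slCover (c t)).val := fun t => by
    rw [hcf t]
    ext i j
    refine (hasDerivAt_slCoverDeriv_comp hc i j t).unique ((hf'f t i j).congr_of_eventuallyEq ?_)
    exact Filter.Eventually.of_forall fun s => congrFun (congrFun (e1 s) i) j
  refine ⟨c, (isGeodesic_iff hc).mpr fun t z => ?_, hc0, ?_⟩
  · rw [e2, ← neg_one_smul ℝ, polarDet_smul_left, polarDet_comm, polarDet_slCoverDeriv_slCover,
      mul_zero]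
  -- The initial velocity is known as a matrix only; injectivity of the differential of the covering
  -- recovers it in coordinates.
  · rw [← sub_eq_zero]
    refine slCoverDeriv_injective m.1 _ ?_
    have := e1 0
    rw [hc0] at this
    rw [map_sub, this]
    simp [hf']

theorem geodesicFrom_spec {m : AdS × AdS} (hm : m ∈ UnitFutureTangent) :
    IsGeodesic (geodesicFrom m) ∧ geodesicFrom m 0 = m.1 ∧ deriv (geodesicFrom m) 0 = m.2 :=
  Classical.epsilon_spec (exists_isGeodesic hm)

theorem slCover_geodesicFrom {m : AdS × AdS} (hm : m ∈ UnitFutureTangent) (t : ℝ) :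
    (slCover (geodesicFrom m t)).val = Real.cos t • (slCover m.1).val
      + Real.sin t • slCoverDeriv m.1 m.2 := by
  obtain ⟨h1, h2, h3⟩ := geodesicFrom_spec hm
  rw [h1.slCover_eq (by rwa [h2, h3]), h2, h3]

/-- The generator of the geodesic flow is the horizontal lift of the velocity. -/
theorem flowGenerator_eq {m : AdS × AdS} (hm : m ∈ UnitFutureTangent) :
    flowGenerator m = (m.2, -christoffel m.1 m.2 m.2) := by
  obtain ⟨h1, h2, h3⟩ := geodesicFrom_spec hm
  have hc' : ContDiff ℝ ∞ (deriv (geodesicFrom m)) := (contDiff_infty_iff_deriv.mp h1.1).2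
  have d := ((h1.1.differentiable (by simp) 0).hasDerivAt.prodMk
    (hc'.differentiable (by simp) 0).hasDerivAt).deriv
  have h4 := h1.2 0
  rw [h2, h3] at h4
  refine d.trans ?_
  rw [h3, ← eq_neg_of_add_eq_zero_left h4]

/-- The generator has zero vertical part, so only the horizontal term of the Sasaki metric survives.
-/
theorem sasakiMetric_flowGenerator {m : AdS × AdS} (hm : m ∈ UnitFutureTangent) (v : AdS × AdS) :
    sasakiMetric m (flowGenerator m) v = adsMetric m.1 m.2 v.1 := by
  rw [flowGenerator_eq hm]
  simp [sasakiMetric, verticalPart]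

end UnitGeodesics

/-! ### Fixed points of elliptic elements and the endpoints of a geodesic -/

section GeodesicProjection

/-- Conjugation moves the fixed point of an elliptic one-parameter group. -/
theorem coe_smul_of_elliptic {L : Matrix (Fin 2) (Fin 2) ℝ} (ht : L 0 0 + L 1 1 = 0)
    (hd : L.det = 1) (hc : L 1 0 < 0) {z : ℍ} (hz : (z : ℂ) = (L 0 0 - Complex.I) / L 1 0)
    (B : SL(2, ℝ)) :
    (B.val * L * (B⁻¹ : SL(2, ℝ)).val) 1 0 < 0 ∧ ((B • z : ℍ) : ℂ) =
      ((B.val * L * (B⁻¹ : SL(2, ℝ)).val) 0 0 - Complex.I) /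
        (B.val * L * (B⁻¹ : SL(2, ℝ)).val) 1 0 := by
  have hden : (B 1 0 : ℂ) * z + B 1 1 ≠ 0 := UpperHalfPlane.denom_ne_zero (B : GL (Fin 2) ℝ) z
  rw [UpperHalfPlane.coe_specialLinearGroup_apply]
  change _ ∧ ((B 0 0 : ℂ) * z + B 0 1) / ((B 1 0 : ℂ) * z + B 1 1) = _
  rw [hz] at hden ⊢
  rw [Matrix.SpecialLinearGroup.coe_inv, Matrix.adjugate_fin_two]
  have hB := B.2
  rw [Matrix.det_fin_two] at hB hd
  simp only [Matrix.mul_apply, Fin.sum_univ_two, Matrix.of_apply,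
    Matrix.cons_val', Matrix.cons_val_zero, Matrix.cons_val_one, Matrix.cons_val_fin_one]
  generalize B.val = b at *
  have hL11 : L 1 1 = -L 0 0 := by linarith
  rw [hL11] at hd ⊢
  have h4 : (b 1 0 * L 0 0 + b 1 1 * L 1 0) * b 1 1
      + (b 1 0 * L 0 1 + b 1 1 * -L 0 0) * -b 1 0 < 0 := by
    -- The lower left entries before and after conjugation have a product which is a sum of squares,
    -- not both zero because the bottom row of `B` is nonzero. So the sign, which selects the fixed
    -- point in the upper half plane, is preserved.
    have e : L 1 0 * ((b 1 0 * L 0 0 + b 1 1 * L 1 0) * b 1 1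
        + (b 1 0 * L 0 1 + b 1 1 * -L 0 0) * -b 1 0) =
        (L 1 0 * b 1 1 + L 0 0 * b 1 0) ^ 2 + b 1 0 ^ 2 := by
      linear_combination b 1 0 ^ 2 * hd
    have e2 : 0 < (L 1 0 * b 1 1 + L 0 0 * b 1 0) ^ 2 + b 1 0 ^ 2 := by
      by_cases h0 : b 1 0 = 0
      · have h3 : b 1 1 ≠ 0 := by
          intro h3
          simp [h0, h3] at hB
        have : L 1 0 * b 1 1 ≠ 0 := mul_ne_zero hc.ne h3
        rw [h0]
        simp only [mul_zero, add_zero]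
        positivity
      · positivity
    rw [← e] at e2
    exact neg_of_mul_pos_right e2 hc.le
  refine ⟨h4, ?_⟩
  have h2' : (L 1 0 : ℂ) ≠ 0 := by exact_mod_cast hc.ne
  have h4'' : (((b 1 0 * L 0 0 + b 1 1 * L 1 0) * b 1 1
      + (b 1 0 * L 0 1 + b 1 1 * -L 0 0) * -b 1 0 : ℝ) : ℂ) ≠ 0 := by
    exact_mod_cast h4.ne
  rw [div_eq_div_iff hden h4'']
  have h1' : (L 0 1 : ℂ) * L 1 0 = - L 0 0 ^ 2 - 1 := by
    have : L 0 1 * L 1 0 = - L 0 0 ^ 2 - 1 := by linarith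
    exact_mod_cast this
  have hB' : (b 0 0 : ℂ) * b 1 1 - b 0 1 * b 1 0 = 1 := by exact_mod_cast hB
  push_cast
  field_simp
  linear_combination (-1) * ((-(b 1 0 : ℂ) * (b 0 0 * b 1 1 - b 0 1 * b 1 0)) * h1'
    + (Complex.I * L 1 0 * b 1 1 - L 0 0 * b 1 0 * (L 0 0 - Complex.I)
      + ((L 0 0 : ℂ) ^ 2 + 1) * b 1 0) * hB' + (b 1 0 : ℂ) * Complex.I_sq)

/-- The stabilizer of the fixed point of an elliptic one-parameter group. -/
theorem smul_eq_self_iff_of_elliptic {L : Matrix (Fin 2) (Fin 2) ℝ} (ht : L 0 0 + L 1 1 = 0)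
    (hd : L.det = 1) (hc : L 1 0 < 0) {z : ℍ} (hz : (z : ℂ) = (L 0 0 - Complex.I) / L 1 0)
    (g : SL(2, ℝ)) : g • z = z ↔ ∃ s k : ℝ, g.val = s • (1 : Matrix (Fin 2) (Fin 2) ℝ) + k • L := by
  have hden : (g 1 0 : ℂ) * z + g 1 1 ≠ 0 := UpperHalfPlane.denom_ne_zero (g : GL (Fin 2) ℝ) z
  have h1 : g • z = z ↔ (g 0 0 : ℂ) * z + g 0 1 = z * ((g 1 0 : ℂ) * z + g 1 1) := by
    rw [UpperHalfPlane.ext_iff, UpperHalfPlane.coe_specialLinearGroup_apply, ← div_eq_iff hden]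
    rfl
  have hc' : (L 1 0 : ℂ) ≠ 0 := by exact_mod_cast hc.ne
  have hL11 : L 1 1 = -L 0 0 := by linarith
  rw [Matrix.det_fin_two, hL11] at hd
  -- Real and imaginary parts of the fixed point equation, with `z` substituted: two real linear
  -- conditions on the entries, whose solutions are the span of `1` and `L`.
  have h2 : ∀ p q r s : ℝ, (p : ℂ) * z + q = z * ((r : ℂ) * z + s) ↔
      p * L 0 0 * L 1 0 + q * L 1 0 ^ 2 = r * (L 0 0 ^ 2 - 1) + s * L 0 0 * L 1 0 ∧
      (p - s) * L 1 0 = 2 * L 0 0 * r := by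
    intro p q r s
    rw [hz]
    field_simp
    rw [Complex.ext_iff]
    simp [pow_two]
    constructor
    · rintro ⟨e1, e2⟩
      exact ⟨by linear_combination e1, by linear_combination -e2⟩
    · rintro ⟨e1, e2⟩
      exact ⟨by linear_combination e1, by linear_combination -e2⟩
  rw [h1, h2]
  constructor
  · rintro ⟨e1, e2⟩
    have hne := hc.ne
    -- Since `L` is traceless, `s` is half the trace of `g`; `k` is read off from the lower left
    -- entry.
    refine ⟨(g 0 0 + g 1 1) / 2, g 1 0 / L 1 0, ?_⟩
    have e3 : g 0 1 = g 1 0 / L 1 0 * L 0 1 := by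
      field_simp
      apply mul_left_cancel₀ hne
      linear_combination e1 - L 0 0 * e2 + g 1 0 * hd
    ext i j
    fin_cases i <;> fin_cases j
    · simp
      field_simp
      linear_combination e2
    · simpa using e3
    · simp
      field_simp
    · simp [hL11]
      field_simp
      linear_combination -e2
  · rintro ⟨s, k, e⟩
    rw [e]
    simp [hL11]
    constructor
    · linear_combination -k * L 1 0 * hd
    · ring

/-- The fixed point of an elliptic one-parameter group is unique. -/
theorem coe_eq_of_elliptic_smul_eq {g : SL(2, ℝ)} (ht : g 0 0 + g 1 1 = 0) (hc : g 1 0 < 0) {z : ℍ}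
    (hz : g • z = z) : (z : ℂ) = (g 0 0 - Complex.I) / g 1 0 := by
  have hden : (g 1 0 : ℂ) * z + g 1 1 ≠ 0 := UpperHalfPlane.denom_ne_zero (g : GL (Fin 2) ℝ) z
  have h1 : (g 0 0 : ℂ) * z + g 0 1 = z * ((g 1 0 : ℂ) * z + g 1 1) := by
    rw [← div_eq_iff hden]
    conv_rhs => rw [← hz, UpperHalfPlane.coe_specialLinearGroup_apply]
    rfl
  have hd : (g 0 0 : ℂ) * g 1 1 - g 0 1 * g 1 0 = 1 := by
    have := g.2
    rw [Matrix.det_fin_two] at this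
    exact_mod_cast this
  have ht' : (g 1 1 : ℂ) = - g 0 0 := by
    have : g 1 1 = - g 0 0 := by linarith
    exact_mod_cast this
  have hc' : (g 1 0 : ℂ) ≠ 0 := by exact_mod_cast hc.ne
  -- The fixed point equation is quadratic with two conjugate roots. As `g 1 0 < 0`, the first
  -- factor would give a point of negative imaginary part.
  have h2 : ((g 1 0 : ℂ) * z - g 0 0 - Complex.I) * ((g 1 0 : ℂ) * z - g 0 0 + Complex.I) = 0 := by
    linear_combination (-(g 1 0 : ℂ)) * h1 - hd + (g 0 0 - g 1 0 * z) * ht' - Complex.I_sq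
  rcases mul_eq_zero.mp h2 with h | h
  · have := congrArg Complex.im h
    simp at this
    nlinarith [z.im_pos]
  · rw [eq_div_iff hc']
    linear_combination h

variable (m : UnitFutureTangent)

theorem leftTranslate_elliptic :
    (leftTranslate m.1.1 m.1.2).val 0 0 + (leftTranslate m.1.1 m.1.2).val 1 1 = 0 ∧
    (leftTranslate m.1.1 m.1.2).val.det = 1 ∧ (leftTranslate m.1.1 m.1.2).val 1 0 < 0 :=
  ⟨sl2_trace _, (mem_unitFutureTangent_iff_leftTranslate m.1).mp m.2⟩

theorem coe_rightPoint : (rightPoint m : ℂ) = ((leftTranslate m.1.1 m.1.2).val 0 0 - Complex.I) /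
    (leftTranslate m.1.1 m.1.2).val 1 0 := rfl

theorem slCover_mul_leftTranslate (x v : AdS) :
    (slCover x).val * (leftTranslate x v).val = slCoverDeriv x v := by
  change (slCover x).val * (((slCover x)⁻¹ : SL(2, ℝ)).val * slCoverDeriv x v) = _
  rw [← Matrix.mul_assoc, ← Matrix.SpecialLinearGroup.coe_mul, mul_inv_cancel]
  simp

/-- The left translate `L` satisfies `L² = -1`, so the right-hand side is the elliptic one-parameter
group `exp (tL)`, which fixes `rightPoint m`. -/
theorem coe_inv_mul_slCover_geodesicFrom (t : ℝ) :
    ((slCover m.1.1)⁻¹ * slCover (geodesicFrom m.1 t)).val =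
      Real.cos t • (1 : Matrix (Fin 2) (Fin 2) ℝ) + Real.sin t • (leftTranslate m.1.1 m.1.2).val := by
  rw [Matrix.SpecialLinearGroup.coe_mul, slCover_geodesicFrom m.2, Matrix.mul_add, Matrix.mul_smul,
    Matrix.mul_smul, ← Matrix.SpecialLinearGroup.coe_mul, inv_mul_cancel]
  rfl

/-- The geodesic with initial data `m` projects to a timelike geodesic of the standard form. -/
theorem adsCover_image_geodesicFrom : adsCover '' Set.range (geodesicFrom m.1) =
    timelikeGeodesic (slCover m.1.1 • rightPoint m) (rightPoint m) := by
  obtain ⟨h1, h2, h3⟩ := leftTranslate_elliptic m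
  ext γ
  constructor
  · rintro ⟨_, ⟨t, rfl⟩, rfl⟩
    change slCover (geodesicFrom m.1 t) • rightPoint m = slCover m.1.1 • rightPoint m
    rw [← inv_smul_eq_iff, ← mul_smul]
    exact (smul_eq_self_iff_of_elliptic h1 h2 h3 (coe_rightPoint m) _).mpr
      ⟨_, _, coe_inv_mul_slCover_geodesicFrom m t⟩
  · intro h
    obtain ⟨g, rfl⟩ := QuotientGroup.mk_surjective γ
    change g • rightPoint m = slCover m.1.1 • rightPoint m at h
    rw [← inv_smul_eq_iff, ← mul_smul] at h
    obtain ⟨s, k, hsk⟩ := (smul_eq_self_iff_of_elliptic h1 h2 h3 (coe_rightPoint m) _).mp h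
    have hdet := ((slCover m.1.1)⁻¹ * g).2
    rw [hsk, Matrix.det_fin_two] at hdet
    rw [Matrix.det_fin_two] at h2
    simp at hdet
    -- For `L` traceless of determinant one, `det (s + kL) = s² + k²`; hence `(s, k)` is `(cos t,
    -- sin t)` for some time `t`, and the whole stabiliser is swept out.
    have hsq : s ^ 2 + k ^ 2 = 1 := by
      linear_combination hdet - k ^ 2 * h2 - s * k * h1
    obtain ⟨t, hs, hk⟩ : ∃ t, s = Real.cos t ∧ k = Real.sin t := by
      have hn : ‖(⟨s, k⟩ : ℂ)‖ = 1 := by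
        rw [← sq_eq_sq₀ (norm_nonneg _) zero_le_one, ← Complex.normSq_eq_norm_sq,
          Complex.normSq_apply]
        linear_combination hsq
      have hne : (⟨s, k⟩ : ℂ) ≠ 0 := norm_ne_zero_iff.mp (by rw [hn]; norm_num)
      refine ⟨Complex.arg ⟨s, k⟩, ?_, ?_⟩
      · rw [Complex.cos_arg hne, hn, div_one]
      · rw [Complex.sin_arg, hn, div_one]
    refine ⟨_, ⟨t, rfl⟩, ?_⟩
    have h4 : (slCover m.1.1)⁻¹ * slCover (geodesicFrom m.1 t) = (slCover m.1.1)⁻¹ * g :=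
      Subtype.ext (by rw [coe_inv_mul_slCover_geodesicFrom, hsk, hs, hk])
    exact congrArg QuotientGroup.mk (mul_left_cancel h4)

/-- The pair is defined by choice, so uniqueness has to be shown: two points of the geodesic already
determine it. -/
theorem geodesicProj_eq : geodesicProj m = (slCover m.1.1 • rightPoint m, rightPoint m) := by
  have h : adsCover '' Set.range (geodesicFrom m.1) =
      timelikeGeodesic (geodesicProj m).1 (geodesicProj m).2 :=
    Classical.epsilon_spec (p := fun z : ℍ × ℍ =>
      adsCover '' Set.range (geodesicFrom m.1) = timelikeGeodesic z.1 z.2)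
      ⟨(_, _), adsCover_image_geodesicFrom m⟩
  obtain ⟨h1, h2, h3⟩ := leftTranslate_elliptic m
  have hmem : ∀ t, slCover (geodesicFrom m.1 t) • (geodesicProj m).2 = (geodesicProj m).1 := fun t =>
    (h ▸ ⟨_, ⟨t, rfl⟩, rfl⟩ :
      adsCover (geodesicFrom m.1 t) ∈ timelikeGeodesic (geodesicProj m).1 (geodesicProj m).2)
  have e0 := hmem 0
  rw [(geodesicFrom_spec m.2).2.1] at e0
  -- At time `π / 2` the translated geodesic passes through `L` itself. Comparison with time `0`
  -- shows that `L` fixes the second component, and `L` has only one fixed point in the upper half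
  -- plane.
  have e1 := hmem (Real.pi / 2)
  rw [← e0, ← inv_smul_eq_iff, ← mul_smul] at e1
  have e2 := coe_inv_mul_slCover_geodesicFrom m (Real.pi / 2)
  rw [Real.cos_pi_div_two, Real.sin_pi_div_two, zero_smul, one_smul, zero_add] at e2
  have e3 : (geodesicProj m).2 = rightPoint m := by
    apply UpperHalfPlane.ext
    rw [coe_eq_of_elliptic_smul_eq (by rw [e2]; exact h1) (by rw [e2]; exact h3) e1, e2,
      coe_rightPoint]
  exact Prod.ext (by rw [← e0, e3]) e3

/-- Conjugating `g⁻¹ N` by `g` gives `N g⁻¹`, so the left endpoint obeys the same formula as the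
right one with the product in the other order. -/
theorem coe_slCover_smul_rightPoint :
    (slCoverDeriv m.1.1 m.1.2 * ((slCover m.1.1)⁻¹ : SL(2, ℝ)).val) 1 0 < 0 ∧
    ((slCover m.1.1 • rightPoint m : ℍ) : ℂ) =
      ((slCoverDeriv m.1.1 m.1.2 * ((slCover m.1.1)⁻¹ : SL(2, ℝ)).val) 0 0 - Complex.I) /
        (slCoverDeriv m.1.1 m.1.2 * ((slCover m.1.1)⁻¹ : SL(2, ℝ)).val) 1 0 := by
  obtain ⟨h1, h2, h3⟩ := leftTranslate_elliptic m
  have := coe_smul_of_elliptic h1 h2 h3 (coe_rightPoint m) (slCover m.1.1)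
  rwa [slCover_mul_leftTranslate] at this

end GeodesicProjection

/-! ### The matrix identity between the canonical form and the two area forms -/

section Algebra

/-- The determinant form of three traceless matrices, as `tr (A [B, C])`. -/
def tripleTrace (A B C : Matrix (Fin 2) (Fin 2) ℝ) : ℝ := Matrix.trace (A * (B * C - C * B))

theorem tripleTrace_conj (g : SL(2, ℝ)) (A B C : Matrix (Fin 2) (Fin 2) ℝ) :
    tripleTrace (g.val * A * (g⁻¹ : SL(2, ℝ)).val) (g.val * B * (g⁻¹ : SL(2, ℝ)).val)
      (g.val * C * (g⁻¹ : SL(2, ℝ)).val) = tripleTrace A B C := by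
  have h : (g⁻¹ : SL(2, ℝ)).val * g.val = 1 := by
    rw [← Matrix.SpecialLinearGroup.coe_mul, inv_mul_cancel]
    rfl
  have h' : ∀ X : Matrix (Fin 2) (Fin 2) ℝ, (g⁻¹ : SL(2, ℝ)).val * (g.val * X) = X := fun X => by
    rw [← Matrix.mul_assoc, h, Matrix.one_mul]
  have e : g.val * A * (g⁻¹ : SL(2, ℝ)).val * (g.val * B * (g⁻¹ : SL(2, ℝ)).val *
      (g.val * C * (g⁻¹ : SL(2, ℝ)).val) - g.val * C * (g⁻¹ : SL(2, ℝ)).val *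
      (g.val * B * (g⁻¹ : SL(2, ℝ)).val)) =
      g.val * (A * (B * C - C * B)) * (g⁻¹ : SL(2, ℝ)).val := by
    simp only [Matrix.mul_assoc, h', Matrix.mul_sub, Matrix.sub_mul]
  rw [tripleTrace, e, Matrix.trace_mul_comm, h', tripleTrace]

/-- This is the Kirillov–Kostant–Souriau form of the adjoint orbit `det = 1`, in the coordinates `a
= L 0 0` and `c = L 1 0`. The area form of the fixed point `(a - i) / c` is `da ∧ dc / c`, so
`tripleTrace` is four times the area. -/
theorem tripleTrace_tangent {L L₁ L₂ : Matrix (Fin 2) (Fin 2) ℝ} (ht : L.trace = 0)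
    (hd : L.det = 1) (ht₁ : L₁.trace = 0) (ht₂ : L₂.trace = 0) (h₁ : polarDet L L₁ = 0)
    (h₂ : polarDet L L₂ = 0) :
    L 1 0 * tripleTrace L L₁ L₂ = 4 * (L₁ 0 0 * L₂ 1 0 - L₂ 0 0 * L₁ 1 0) := by
  rw [Matrix.trace_fin_two] at ht ht₁ ht₂
  have e : L 1 1 = -L 0 0 := by linarith
  have e₁ : L₁ 1 1 = -L₁ 0 0 := by linarith
  have e₂ : L₂ 1 1 = -L₂ 0 0 := by linarith
  rw [Matrix.det_fin_two, e] at hd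
  rw [polarDet, e, e₁] at h₁
  rw [polarDet, e, e₂] at h₂
  simp only [tripleTrace, Matrix.trace_fin_two, Matrix.mul_apply, Matrix.sub_apply,
    Fin.sum_univ_two, e, e₁, e₂]
  linear_combination 4 * (L₁ 0 0 * L₂ 1 0 - L₂ 0 0 * L₁ 1 0) * hd
    - 2 * (L 0 0 * L₂ 1 0 - L 1 0 * L₂ 0 0) * h₁ + 2 * (L 0 0 * L₁ 1 0 - L 1 0 * L₁ 0 0) * h₂

/-- The heart of the computation. If `g` moves with `g⁻¹ g' = X` and `L` with velocity `L'`, then `g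
L g⁻¹` moves with the conjugate by `g` of `L' + [X, L]`, and `N = g L` moves with `g (L' + X L)`.
The left side is thus four times the difference of the areas at the two endpoints, and the right
side four times the canonical form. -/
theorem tripleTrace_twist {L L₁ L₂ X Y : Matrix (Fin 2) (Fin 2) ℝ} (ht : L.trace = 0)
    (hd : L.det = 1) (ht₁ : L₁.trace = 0) (ht₂ : L₂.trace = 0) (h₁ : polarDet L L₁ = 0)
    (h₂ : polarDet L L₂ = 0) (hX : X.trace = 0) (hY : Y.trace = 0) (hc : L 1 0 ≠ 0) :
    tripleTrace L (L₁ + X * L - L * X) (L₂ + Y * L - L * Y) - tripleTrace L L₁ L₂ =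
      4 * (polarDet (L₁ + X * L) Y - polarDet (L₂ + Y * L) X) := by
  rw [Matrix.trace_fin_two] at ht ht₁ ht₂ hX hY
  have e : L 1 1 = -L 0 0 := by linarith
  have e₁ : L₁ 1 1 = -L₁ 0 0 := by linarith
  have e₂ : L₂ 1 1 = -L₂ 0 0 := by linarith
  have eX : X 1 1 = -X 0 0 := by linarith
  have eY : Y 1 1 = -Y 0 0 := by linarith
  rw [Matrix.det_fin_two, e] at hd
  rw [polarDet, e, e₁] at h₁
  rw [polarDet, e, e₂] at h₂
  -- The upper right entries are solved from `det L = 1` and from tangency, leaving an identity of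
  -- rational functions in free variables.
  have eb : L 0 1 = -(1 + L 0 0 ^ 2) / L 1 0 := by
    field_simp
    linear_combination -hd
  have eb₁ : L₁ 0 1 = -(2 * L 0 0 * L₁ 0 0 + L 0 1 * L₁ 1 0) / L 1 0 := by
    field_simp
    linear_combination -h₁
  have eb₂ : L₂ 0 1 = -(2 * L 0 0 * L₂ 0 0 + L 0 1 * L₂ 1 0) / L 1 0 := by
    field_simp
    linear_combination -h₂
  simp only [tripleTrace, polarDet, Matrix.trace_fin_two, Matrix.mul_apply, Matrix.sub_apply,
    Matrix.add_apply, Fin.sum_univ_two, e, e₁, e₂, eX, eY, eb₁, eb₂, eb]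
  field_simp
  ring

theorem polarDet_mul_left (g : SL(2, ℝ)) (A B : Matrix (Fin 2) (Fin 2) ℝ) :
    polarDet (g.val * A) (g.val * B) = polarDet A B := by
  have hd := g.2
  rw [Matrix.det_fin_two] at hd
  simp only [polarDet, Matrix.mul_apply, Fin.sum_univ_two]
  linear_combination (A 0 0 * B 1 1 + A 1 1 * B 0 0 - A 0 1 * B 1 0 - A 1 0 * B 0 1) * hd

theorem trace_adjugate_mul (A B : Matrix (Fin 2) (Fin 2) ℝ) :
    Matrix.trace (A.adjugate * B) = polarDet A B := by
  rw [Matrix.adjugate_fin_two]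
  simp only [Matrix.trace_fin_two, Matrix.mul_apply, Fin.sum_univ_two, polarDet, Matrix.of_apply,
    Matrix.cons_val', Matrix.cons_val_zero, Matrix.cons_val_one, Matrix.cons_val_fin_one]
  ring

theorem trace_inv_mul (g : SL(2, ℝ)) (A : Matrix (Fin 2) (Fin 2) ℝ) :
    Matrix.trace ((g⁻¹ : SL(2, ℝ)).val * A) = polarDet g.val A := by
  rw [Matrix.SpecialLinearGroup.coe_inv, trace_adjugate_mul]

/-- Polarisation of `adj(A) A = det A`. For `B` tangent at `A = g` the right side vanishes, and
`adj(B) = -g⁻¹ B g⁻¹` is the derivative of the inverse. -/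
theorem adjugate_mul_add (A B : Matrix (Fin 2) (Fin 2) ℝ) :
    A.adjugate * B + B.adjugate * A = polarDet A B • 1 := by
  rw [Matrix.adjugate_fin_two, Matrix.adjugate_fin_two]
  ext i j
  simp only [Matrix.add_apply, Matrix.mul_apply, Fin.sum_univ_two, polarDet, Matrix.smul_apply]
  fin_cases i <;> fin_cases j <;> simp <;> ring

/-- For a frame `(g, N)` of a negative definite plane of matrices, the canonical symplectic form is
the difference of the area forms of the two endpoint maps, determined by `N g⁻¹` and `g⁻¹ N`. -/
theorem symplectic_eq_area_sub_area (g : SL(2, ℝ)) {N g₁ N₁ g₂ N₂ : Matrix (Fin 2) (Fin 2) ℝ}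
    (hN : N.det = 1) (hgN : polarDet g.val N = 0)
    (hg₁ : polarDet g.val g₁ = 0) (hN₁ : polarDet N N₁ = 0)
    (hgN₁ : polarDet g₁ N + polarDet g.val N₁ = 0)
    (hg₂ : polarDet g.val g₂ = 0) (hN₂ : polarDet N N₂ = 0)
    (hgN₂ : polarDet g₂ N + polarDet g.val N₂ = 0)
    (hc : (g.val.adjugate * N) 1 0 ≠ 0) (hc' : (N * g.val.adjugate) 1 0 ≠ 0) :
    polarDet N₁ g₂ - polarDet N₂ g₁ =
      ((N₁ * g.val.adjugate + N * g₁.adjugate) 0 0 * (N₂ * g.val.adjugate + N * g₂.adjugate) 1 0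
        - (N₂ * g.val.adjugate + N * g₂.adjugate) 0 0 *
          (N₁ * g.val.adjugate + N * g₁.adjugate) 1 0) / (N * g.val.adjugate) 1 0
      - ((g.val.adjugate * N₁ + g₁.adjugate * N) 0 0 * (g.val.adjugate * N₂ + g₂.adjugate * N) 1 0
        - (g.val.adjugate * N₂ + g₂.adjugate * N) 0 0 *
          (g.val.adjugate * N₁ + g₁.adjugate * N) 1 0) / (g.val.adjugate * N) 1 0 := by
  have hadj : g.val.adjugate = (g⁻¹ : SL(2, ℝ)).val :=
    (Matrix.SpecialLinearGroup.coe_inv g).symm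
  have hinv : (g⁻¹ : SL(2, ℝ)).val * g.val = 1 := by
    rw [← Matrix.SpecialLinearGroup.coe_mul, inv_mul_cancel]
    rfl
  have hinv' : g.val * (g⁻¹ : SL(2, ℝ)).val = 1 := by
    rw [← Matrix.SpecialLinearGroup.coe_mul, mul_inv_cancel]
    rfl
  have c1 : ∀ X : Matrix (Fin 2) (Fin 2) ℝ, g.val * ((g⁻¹ : SL(2, ℝ)).val * X) = X := fun X => by
    rw [← Matrix.mul_assoc, hinv', Matrix.one_mul]
  have c2 : ∀ X : Matrix (Fin 2) (Fin 2) ℝ, (g⁻¹ : SL(2, ℝ)).val * (g.val * X) = X := fun X => by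
    rw [← Matrix.mul_assoc, hinv, Matrix.one_mul]
  set L := g.val.adjugate * N with hL
  have hNL : N = g.val * L := by rw [hL, hadj, c1]
  have hLt : L.trace = 0 := by rw [hL, hadj, trace_inv_mul, hgN]
  have hLd : L.det = 1 := by rw [hL, hadj, Matrix.det_mul, hN, g⁻¹.2, one_mul]
  -- the derivative of the left translate, in terms of the translated velocity
  have key : ∀ g' N' : Matrix (Fin 2) (Fin 2) ℝ, polarDet g.val g' = 0 → polarDet N N' = 0 →
      polarDet g' N + polarDet g.val N' = 0 → ∃ L' X : Matrix (Fin 2) (Fin 2) ℝ,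
      g.val.adjugate * N' + g'.adjugate * N = L' ∧
      N' * g.val.adjugate + N * g'.adjugate = g.val * (L' + X * L - L * X) * (g⁻¹ : SL(2, ℝ)).val ∧
      g' = g.val * X ∧ N' = g.val * (L' + X * L) ∧ X.trace = 0 ∧ L'.trace = 0 ∧
      polarDet L L' = 0 := by
    intro g' N' h1 h2 h3
    have hX : g' = g.val * ((g⁻¹ : SL(2, ℝ)).val * g') := (c1 g').symm
    set X := (g⁻¹ : SL(2, ℝ)).val * g' with hXdef
    have hXt : X.trace = 0 := by rw [hXdef, trace_inv_mul, h1]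
    have h4 : g'.adjugate = -(X * (g⁻¹ : SL(2, ℝ)).val) := by
      have h5 := adjugate_mul_add g.val g'
      rw [h1, zero_smul, hadj] at h5
      have h6 : g'.adjugate * g.val * (g⁻¹ : SL(2, ℝ)).val = g'.adjugate := by
        rw [Matrix.mul_assoc, hinv', Matrix.mul_one]
      rw [← h6, eq_neg_of_add_eq_zero_right h5, Matrix.neg_mul]
    refine ⟨_, X, rfl, ?_, hX, ?_, hXt, ?_, ?_⟩
    · rw [h4, hadj, hNL]
      simp only [Matrix.mul_add, Matrix.mul_sub, Matrix.add_mul, Matrix.sub_mul, Matrix.mul_assoc,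
        Matrix.neg_mul, Matrix.mul_neg, c1, c2]
      abel
    · rw [h4, hadj, hNL]
      simp only [Matrix.mul_add, Matrix.mul_assoc, Matrix.neg_mul, Matrix.mul_neg, c1, c2]
      abel
    · rw [Matrix.trace_add, hadj, trace_inv_mul, trace_adjugate_mul]
      linarith
    · have h5 : polarDet L ((g⁻¹ : SL(2, ℝ)).val * N') = 0 := by
        rw [hL, hadj, polarDet_mul_left, h2]
      have h6 : polarDet L (X * L) = 0 := by
        have : polarDet L (X * L) = L.det * X.trace := by
          rw [Matrix.det_fin_two, Matrix.trace_fin_two]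
          simp [polarDet, Matrix.mul_apply, Fin.sum_univ_two]
          ring
        rw [this, hXt, mul_zero]
      have h7 : g'.adjugate * N = -(X * L) := by
        rw [h4, hNL, Matrix.neg_mul, Matrix.mul_assoc, c2]
      rw [h7, hadj, polarDet_add_right, h5, ← neg_one_smul ℝ, polarDet_smul_right, h6]
      ring
  obtain ⟨L₁, X₁, eL₁, eM₁, eg₁, eN₁, hX₁, hL₁, hLL₁⟩ := key g₁ N₁ hg₁ hN₁ hgN₁
  obtain ⟨L₂, X₂, eL₂, eM₂, eg₂, eN₂, hX₂, hL₂, hLL₂⟩ := key g₂ N₂ hg₂ hN₂ hgN₂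
  have eM : N * g.val.adjugate = g.val * L * (g⁻¹ : SL(2, ℝ)).val := by rw [← hNL, hadj]
  -- The velocity of `N g⁻¹` is tangent to the adjoint orbit, as `tripleTrace_tangent` requires.
  have htw : ∀ L' X : Matrix (Fin 2) (Fin 2) ℝ, L'.trace = 0 → X.trace = 0 → polarDet L L' = 0 →
      (g.val * (L' + X * L - L * X) * (g⁻¹ : SL(2, ℝ)).val).trace = 0 ∧
      polarDet (g.val * L * (g⁻¹ : SL(2, ℝ)).val)
        (g.val * (L' + X * L - L * X) * (g⁻¹ : SL(2, ℝ)).val) = 0 := by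
    intro L' X h1 h2 h3
    have hconj : ∀ A B : Matrix (Fin 2) (Fin 2) ℝ, polarDet (A * (g⁻¹ : SL(2, ℝ)).val)
        (B * (g⁻¹ : SL(2, ℝ)).val) = polarDet A B := fun A B => by
      have hd := g⁻¹.2
      rw [Matrix.det_fin_two] at hd
      simp only [polarDet, Matrix.mul_apply, Fin.sum_univ_two]
      linear_combination (A 0 0 * B 1 1 + A 1 1 * B 0 0 - A 0 1 * B 1 0 - A 1 0 * B 0 1) * hd
    constructor
    · rw [Matrix.trace_mul_comm, c2, Matrix.trace_sub, Matrix.trace_add, Matrix.trace_mul_comm X, h1]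
      ring
    · rw [hconj, polarDet_mul_left]
      rw [polarDet] at h3 ⊢
      simp only [Matrix.sub_apply, Matrix.add_apply, Matrix.mul_apply, Fin.sum_univ_two]
      linear_combination h3
  have t1 := tripleTrace_tangent hLt hLd hL₁ hL₂ hLL₁ hLL₂
  have t2 := tripleTrace_tangent (L := g.val * L * (g⁻¹ : SL(2, ℝ)).val)
    (by rw [Matrix.trace_mul_comm, c2, hLt])
    (by rw [Matrix.det_mul, Matrix.det_mul, hLd, g.2, g⁻¹.2]; norm_num)
    (htw L₁ X₁ hL₁ hX₁ hLL₁).1 (htw L₂ X₂ hL₂ hX₂ hLL₂).1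
    (htw L₁ X₁ hL₁ hX₁ hLL₁).2 (htw L₂ X₂ hL₂ hX₂ hLL₂).2
  rw [tripleTrace_conj] at t2
  have t3 := tripleTrace_twist hLt hLd hL₁ hL₂ hLL₁ hLL₂ hX₁ hX₂ hc
  rw [eM] at hc' ⊢
  rw [eL₁, eL₂, eM₁, eM₂, eN₁, eN₂, eg₁, eg₂, polarDet_mul_left, polarDet_mul_left]
  have s1 := eq_div_of_mul_eq hc ((mul_comm _ _).trans t1)
  have s2 := eq_div_of_mul_eq hc' ((mul_comm _ _).trans t2)
  rw [s1, s2, mul_div_assoc, mul_div_assoc] at t3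
  linarith

end Algebra

/-! ### The unit tangent bundle in coordinates, invariance of the connection form, descent -/

section UnitFutureTangent

theorem contDiff_futureCoord : ContDiff ℝ ∞ futureCoord := by
  have h1 : ContDiff ℝ ∞ fun m : AdS × ℂ => adsRadius m.1 := contDiff_adsRadius.comp contDiff_fst
  have h2 : ∀ m : AdS × ℂ, adsRadius m.1 ≠ 0 := fun m => (adsRadius_pos m.1).ne'
  have h3 : ContDiff ℝ ∞ fun m : AdS × ℂ => m.1.1.re :=
    Complex.reCLM.contDiff.comp (contDiff_fst.comp contDiff_fst)
  have h4 : ContDiff ℝ ∞ fun m : AdS × ℂ => m.1.1.im :=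
    Complex.imCLM.contDiff.comp (contDiff_fst.comp contDiff_fst)
  have h5 : ContDiff ℝ ∞ fun m : AdS × ℂ => m.2.re := Complex.reCLM.contDiff.comp contDiff_snd
  have h6 : ContDiff ℝ ∞ fun m : AdS × ℂ => m.2.im := Complex.imCLM.contDiff.comp contDiff_snd
  refine ContDiff.div (ContDiff.sqrt ?_ fun m => (futureCoord_aux m).ne') h1 h2
  exact ((contDiff_const.add (h5.pow 2)).add (h6.pow 2)).sub
    ((((h3.mul h5).add (h4.mul h6)).div h1 h2).pow 2)

theorem chartAt_unitFutureTangent (m : UnitFutureTangent) :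
    ⇑(chartAt (AdS × ℂ) m) = unitFutureTangentHomeo := rfl

theorem chartAt_symm_unitFutureTangent (m : UnitFutureTangent) (y : AdS × ℂ) :
    (chartAt (AdS × ℂ) m).symm y = unitFutureTangentHomeo.symm y := by
  have h := (chartAt (AdS × ℂ) m).left_inv (x := unitFutureTangentHomeo.symm y) trivial
  rwa [chartAt_unitFutureTangent, Homeomorph.apply_symm_apply] at h

theorem hasMFDerivAt_unitFutureTangentHomeo_symm (y : AdS × ℂ) :
    HasMFDerivAt 𝓘(ℝ, AdS × ℂ) 𝓘(ℝ, AdS × ℂ) unitFutureTangentHomeo.symm y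
      (ContinuousLinearMap.id ℝ (AdS × ℂ)) := by
  refine hasMFDerivAt_of_comp_chartAt chartAt_unitFutureTangent
    unitFutureTangentHomeo.symm.continuous.continuousAt ?_
  have h : unitFutureTangentHomeo ∘ unitFutureTangentHomeo.symm = id := by
    ext1 y; simp
  rw [h]
  exact hasMFDerivAt_id _

theorem hasMFDerivAt_unitFutureTangent_val (m : UnitFutureTangent) :
    HasMFDerivAt 𝓘(ℝ, AdS × ℂ) 𝓘(ℝ, AdS × AdS) (Subtype.val : UnitFutureTangent → AdS × AdS) m
      ((ContinuousLinearMap.fst ℝ AdS ℂ).prod ((ContinuousLinearMap.snd ℝ AdS ℂ).prod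
        (fderiv ℝ futureCoord (unitFutureTangentHomeo m)))) := by
  have h1 : HasFDerivAt (fun y : AdS × ℂ => ((y.1, y.2, futureCoord y) : AdS × AdS))
      ((ContinuousLinearMap.fst ℝ AdS ℂ).prod ((ContinuousLinearMap.snd ℝ AdS ℂ).prod
        (fderiv ℝ futureCoord (unitFutureTangentHomeo m)))) (unitFutureTangentHomeo m) :=
    hasFDerivAt_fst.prodMk (hasFDerivAt_snd.prodMk
      (contDiff_futureCoord.differentiable (by simp) _).hasFDerivAt)
  have h2 := HasMFDerivAt.comp m h1.hasMFDerivAt (hasMFDerivAt_chartAt (E := AdS × ℂ) m)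
  have h3 : (Subtype.val : UnitFutureTangent → AdS × AdS) =
      (fun y : AdS × ℂ => ((y.1, y.2, futureCoord y) : AdS × AdS)) ∘ unitFutureTangentHomeo := by
    funext m
    exact congrArg Subtype.val (unitFutureTangentHomeo.symm_apply_apply m).symm
  rw [h3]
  exact h2

theorem connectionForm_apply (m : UnitFutureTangent) (v : Fin 1 → AdS × ℂ) :
    connectionForm m v = -adsMetric m.1.1 m.1.2 (v 0).1 := by
  simp only [connectionForm]
  rw [(hasMFDerivAt_unitFutureTangent_val m).mfderiv]
  exact congrArg Neg.neg (sasakiMetric_flowGenerator m.2 _)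

/-- An isometry changes left translates by conjugation, and the trace form is conjugation invariant.
-/
theorem adsMetric_isom (F : adsIsom) (x v w : AdS) :
    adsMetric ((F : Equiv.Perm AdS) x) (fderiv ℝ (F : Equiv.Perm AdS) x v)
      (fderiv ℝ (F : Equiv.Perm AdS) x w) = adsMetric x v w := by
  obtain ⟨α, β, h⟩ := F.2.2.2
  obtain ⟨A, B, -, hAB⟩ := adsIsom_lift F h
  rw [adsMetric_eq_trace, adsMetric_eq_trace, leftTranslate_isom F A B hAB,
    leftTranslate_isom F A B hAB]
  have hB : (B⁻¹ : SL(2, ℝ)).val * B.val = 1 := by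
    rw [← Matrix.SpecialLinearGroup.coe_mul, inv_mul_cancel]
    rfl
  have hB' : ∀ X : Matrix (Fin 2) (Fin 2) ℝ, (B⁻¹ : SL(2, ℝ)).val * (B.val * X) = X := fun X => by
    rw [← Matrix.mul_assoc, hB, Matrix.one_mul]
  rw [Matrix.mul_assoc, Matrix.mul_assoc B.val, Matrix.mul_assoc B.val, hB', Matrix.trace_mul_comm]
  simp only [Matrix.mul_assoc, hB, Matrix.mul_one]

/-- The differential of the action of an isometry, in coordinates. -/
theorem exists_hasMFDerivAt_smul (F : adsIsom) (m : UnitFutureTangent) :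
    ∃ D : AdS × ℂ →L[ℝ] AdS × ℂ,
      HasMFDerivAt 𝓘(ℝ, AdS × ℂ) 𝓘(ℝ, AdS × ℂ) (fun m : UnitFutureTangent => F • m) m D ∧
      ∀ v, (D v).1 = fderiv ℝ (F : Equiv.Perm AdS) m.1.1 v.1 := by
  have hF := adsIsom_contDiff F
  have h1 : HasFDerivAt (fun y : AdS × ℂ => (F : Equiv.Perm AdS) y.1)
      (fderiv ℝ (F : Equiv.Perm AdS) m.1.1 ∘L ContinuousLinearMap.fst ℝ AdS ℂ)
      (unitFutureTangentHomeo m) :=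
    ((hF.differentiable (by simp) m.1.1).hasFDerivAt).comp (unitFutureTangentHomeo m)
      hasFDerivAt_fst
  have h2 : ContDiff ℝ ∞ (fun y : AdS × ℂ =>
      (fderiv ℝ (F : Equiv.Perm AdS) y.1 (y.2, futureCoord y)).1) :=
    contDiff_fst.comp (((hF.fderiv_right (m := ∞) (by simp)).comp contDiff_fst).clm_apply
      (contDiff_snd.prodMk contDiff_futureCoord))
  have h3 := h1.prodMk (h2.differentiable (by simp) (unitFutureTangentHomeo m)).hasFDerivAt
  have h4 := HasMFDerivAt.comp m h3.hasMFDerivAt (hasMFDerivAt_chartAt (E := AdS × ℂ) m)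
  refine ⟨_, hasMFDerivAt_of_comp_chartAt chartAt_unitFutureTangent
    (continuous_const_smul F).continuousAt (h4.congr_of_eventuallyEq
      (Filter.Eventually.of_forall fun m' => ?_)), fun v => rfl⟩
  have h5 : m'.1 = (unitFutureTangentHomeo.symm (unitFutureTangentHomeo m')).1 :=
    congrArg Subtype.val (unitFutureTangentHomeo.symm_apply_apply m').symm
  refine Prod.ext rfl ?_
  change (fderiv ℝ (F : Equiv.Perm AdS) m'.1.1 m'.1.2).1 = _
  rw [h5]
  rfl

/-- The form involves only the base component of a tangent vector, on which the isometry acts by its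
differential, so invariance of the metric suffices. -/
theorem pullback_smul_connectionForm (F : adsIsom) :
    connectionForm.pullback (I := 𝓘(ℝ, AdS × ℂ)) (fun m : UnitFutureTangent => F • m) =
      connectionForm := by
  funext m
  obtain ⟨D, hD, hD'⟩ := exists_hasMFDerivAt_smul F m
  refine ContinuousAlternatingMap.ext fun v => ?_
  change Fin 1 → AdS × ℂ at v
  rw [DiffForm.pullback_apply_of_hasMFDerivAt hD]
  refine (connectionForm_apply _ _).trans ((connectionForm_apply _ _).trans ?_).symm
  rw [hD']
  exact congrArg Neg.neg (adsMetric_isom F _ _ _).symm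

variable {Γ : Type*} [Group Γ] {ρl ρr : Γ →* PSL(2, ℝ)} (ρ : IsomLift ρl ρr)

theorem PrincipalBundle.exists_deck {m m' : UnitFutureTangent}
    (h : (Quotient.mk _ m : PrincipalBundle ρ) = Quotient.mk _ m') :
    ∃ τ : Γ, ρ.toHom τ • m = m' ∧ ∀ n : UnitFutureTangent,
      (Quotient.mk _ (ρ.toHom τ • n) : PrincipalBundle ρ) = Quotient.mk _ n := by
  obtain ⟨⟨_, τ, rfl⟩, h2⟩ := Quotient.exact h.symm
  exact ⟨τ, h2, fun n => Quotient.sound ⟨⟨_, τ, rfl⟩, rfl⟩⟩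

/-- The projection to the space of timelike geodesics is equivariant. -/
theorem geodesicProj_smul (τ : Γ) (m : UnitFutureTangent) :
    geodesicProj (ρ.toHom τ • m) = (ρl τ • (geodesicProj m).1, ρr τ • (geodesicProj m).2) := by
  rw [geodesicProj_eq, geodesicProj_eq, rightPoint_smul _ (ρ.covers τ)]
  refine Prod.ext ?_ rfl
  change adsCover ((ρ.toHom τ : Equiv.Perm AdS) m.1.1) • ρr τ • rightPoint m =
    ρl τ • adsCover m.1.1 • rightPoint m
  rw [ρ.covers, smul_smul, smul_smul, inv_mul_cancel_right]

/-- Equivariance of `geodesicProj` makes the induced map well defined, which is what the choice in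
`bundleProj` needs. -/
theorem bundleProj_mk (m : UnitFutureTangent) : bundleProj ρ (Quotient.mk _ m) =
    (Quotient.mk _ (geodesicProj m).1, Quotient.mk _ (geodesicProj m).2) := by
  refine Classical.epsilon_spec (p := fun F : PrincipalBundle ρ →
    FuchsianSurface ρl × FuchsianSurface ρr => ∀ m : UnitFutureTangent,
    F (Quotient.mk _ m) = (Quotient.mk _ (geodesicProj m).1, Quotient.mk _ (geodesicProj m).2))
    ⟨Quotient.lift (fun m => (Quotient.mk _ (geodesicProj m).1, Quotient.mk _ (geodesicProj m).2))
      fun m m' h => ?_, fun _ => rfl⟩ m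
  obtain ⟨⟨_, τ, rfl⟩, h2⟩ := h
  change ρ.toHom τ • m' = m at h2
  rw [← h2, geodesicProj_smul]
  exact Prod.ext (Quotient.sound ⟨⟨_, τ, rfl⟩, rfl⟩) (Quotient.sound ⟨⟨_, τ, rfl⟩, rfl⟩)

variable [IsFuchsian ρr]

theorem PrincipalBundle.isQuotientCharted :
    IsQuotientCharted (E := AdS × ℂ)
      (Quotient.mk (MulAction.orbitRel ρ.toHom.range UnitFutureTangent))
      (Function.surjInv Quotient.mk_surjective) :=
  (PrincipalBundle.isLocalHomeomorph_mk ρ).isQuotientCharted _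

theorem PrincipalBundle.mdifferentiableAt_mk (m : UnitFutureTangent) :
    MDifferentiableAt 𝓘(ℝ, AdS × ℂ) 𝓘(ℝ, AdS × ℂ)
      (Quotient.mk (MulAction.orbitRel ρ.toHom.range UnitFutureTangent)) m := by
  obtain ⟨τ, h1, h2⟩ := PrincipalBundle.exists_deck ρ
    (PrincipalBundle.isQuotientCharted ρ (Quotient.mk _ m)).1.symm
  obtain ⟨D, hD, -⟩ := exists_hasMFDerivAt_smul (ρ.toHom τ) m
  exact ((PrincipalBundle.isQuotientCharted ρ).hasMFDerivAt h1 h2 hD).mdifferentiableAt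

theorem pullback_bundleConnectionForm : (bundleConnectionForm ρ).pullback
    (Quotient.mk (MulAction.orbitRel ρ.toHom.range UnitFutureTangent)) = connectionForm := by
  refine Classical.epsilon_spec (p := fun η : DiffForm 𝓘(ℝ, AdS × ℂ) (PrincipalBundle ρ) 1 =>
    η.pullback (Quotient.mk (MulAction.orbitRel ρ.toHom.range UnitFutureTangent)) =
      connectionForm) ?_
  refine (PrincipalBundle.isQuotientCharted ρ).exists_pullback_eq _ fun m m' h => ?_
  obtain ⟨τ, h1, h2⟩ := PrincipalBundle.exists_deck ρ h
  obtain ⟨D, hD, -⟩ := exists_hasMFDerivAt_smul (ρ.toHom τ) m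
  exact ⟨fun n => ρ.toHom τ • n, h1, h2, hD.mdifferentiableAt,
    congrFun (pullback_smul_connectionForm (ρ.toHom τ)) m⟩

end UnitFutureTangent

/-! ### The exterior derivative of the connection form in coordinates -/

section Curvature

/-- This fixes the normalisation: the alternation carries no factor `½`, so the `½` of the curvature
formula comes from the metric. -/
theorem extDeriv_ofSubsingleton {E : Type*} [NormedAddCommGroup E] [NormedSpace ℝ E]
    {A : E → E →L[ℝ] ℝ} {A' : E →L[ℝ] E →L[ℝ] ℝ} {y : E} (h : HasFDerivAt A A' y) (v : Fin 2 → E) :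
    extDeriv (fun y => ContinuousAlternatingMap.ofSubsingleton ℝ E ℝ (0 : Fin 1) (A y)) y v =
      A' (v 0) (v 1) - A' (v 1) (v 0) := by
  have h2 : HasFDerivAt
      (fun y => ContinuousAlternatingMap.ofSubsingleton ℝ E ℝ (0 : Fin 1) (A y)) _ y :=
    (ContinuousAlternatingMap.ofSubsingletonLIE (𝕜 := ℝ) (E := E) (F := ℝ)
      (0 : Fin 1)).toContinuousLinearEquiv.toContinuousLinearMap.hasFDerivAt.comp y h
  rw [extDeriv, h2.fderiv, ContinuousAlternatingMap.alternatizeUncurryFin_apply, Fin.sum_univ_two]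
  simp only [Fin.val_zero, pow_zero, one_smul, Fin.val_one, pow_one, neg_smul, ← sub_eq_add_neg]
  rfl

/-- The hyperbolic area form in the coordinates `(a, c)` of the point `(a - i) / c`. -/
theorem hyperbolicAreaForm_of_elliptic {E : Type*} [NormedAddCommGroup E] [NormedSpace ℝ E]
    {a c : E → ℝ} {a' c' : E →L[ℝ] ℝ} {y : E} (ha : HasFDerivAt a a' y) (hc : HasFDerivAt c c' y)
    {f : E → ℍ} (hneg : c y < 0) (hf : ∀ y, (f y : ℂ) = (a y - Complex.I) / c y) :
    ∃ D : E →L[ℝ] ℂ, HasMFDerivAt 𝓘(ℝ, E) 𝓘(ℝ, ℂ) f y D ∧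
      ∀ v : Fin 2 → E, hyperbolicAreaForm (f y) (fun i => D (v i)) =
        (a' (v 0) * c' (v 1) - a' (v 1) * c' (v 0)) / c y := by
  have hinv : HasFDerivAt (fun y => (c y)⁻¹) _ y := (hasDerivAt_inv hneg.ne).comp_hasFDerivAt y hc
  have h1 := ha.mul hinv
  have h2 := (Complex.ofRealCLM.hasFDerivAt.comp y h1).sub
    ((Complex.ofRealCLM.hasFDerivAt.comp y hinv).mul_const Complex.I)
  have h3 : (fun y => (f y : ℂ)) = fun y => ((a y * (c y)⁻¹ : ℝ) : ℂ) - ((c y)⁻¹ : ℝ) * Complex.I := by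
    funext y
    rw [hf]
    push_cast
    ring
  have h4 : HasFDerivAt (fun y => (f y : ℂ))
      (Complex.ofRealCLM ∘L (a y • -(c y ^ 2)⁻¹ • c' + (c y)⁻¹ • a') -
        Complex.I • Complex.ofRealCLM ∘L (-(c y ^ 2)⁻¹ • c')) y := by
    rw [h3]
    exact h2
  refine ⟨_, hasMFDerivAt_upperHalfPlane h4.hasMFDerivAt, fun v => ?_⟩
  -- The point has real part `a / c` and imaginary part `-1 / c`, so `dx ∧ dy = da ∧ dc / c³` and
  -- division by the squared imaginary part leaves `da ∧ dc / c`.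
  have him : (f y).im = -(c y)⁻¹ := by
    change ((f y : ℂ)).im = _
    rw [congrFun h3 y]
    simp
  refine (hyperbolicAreaForm_apply _ _).trans ?_
  rw [him]
  have hne := hneg.ne
  simp [pow_two]
  field_simp
  ring

/-- The unit velocity, as a matrix, in terms of the coordinates on the unit tangent bundle. -/
noncomputable def slVelocity (y : AdS × ℂ) : Matrix (Fin 2) (Fin 2) ℝ :=
  slCoverDeriv y.1 (y.2, futureCoord y)

/-- The derivative of `slVelocity`. -/
noncomputable def slVelocityDeriv (y v : AdS × ℂ) : Matrix (Fin 2) (Fin 2) ℝ :=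
  Matrix.of fun i j => fderiv ℝ (fun y => slVelocity y i j) y v

theorem hasFDerivAt_slVelocity (i j : Fin 2) (y : AdS × ℂ) :
    HasFDerivAt (fun y => slVelocity y i j) (fderiv ℝ (fun y => slVelocity y i j) y) y := by
  have h : ContDiff ℝ ∞ fun y => slVelocity y i j :=
    (((contDiff_slCover i j).fderiv_right (m := ∞) (by simp)).comp contDiff_fst).clm_apply
      (contDiff_snd.prodMk contDiff_futureCoord)
  exact (h.differentiable (by simp) y).hasFDerivAt

theorem hasFDerivAt_slCover_fst (i j : Fin 2) (y : AdS × ℂ) :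
    HasFDerivAt (fun y : AdS × ℂ => slCover y.1 i j)
      (fderiv ℝ (fun x => slCover x i j) y.1 ∘L ContinuousLinearMap.fst ℝ AdS ℂ) y :=
  (hasFDerivAt_slCover i j y.1).comp y hasFDerivAt_fst

theorem slVelocity_det (y : AdS × ℂ) : (slVelocity y).det = 1 :=
  det_slCoverDeriv (m := (y.1, y.2, futureCoord y)) ((mem_unitFutureTangent_iff _).mpr rfl)

theorem polarDet_slVelocity (y : AdS × ℂ) : polarDet (slCover y.1).val (slVelocity y) = 0 := by
  rw [polarDet_comm]
  exact polarDet_slCoverDeriv_slCover _ _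

theorem exists_hasFDerivAt_polarDet {E : Type*} [NormedAddCommGroup E] [NormedSpace ℝ E]
    {f g : E → Matrix (Fin 2) (Fin 2) ℝ} {f' g' : Fin 2 → Fin 2 → E →L[ℝ] ℝ}
    {y : E} (hf : ∀ i j, HasFDerivAt (fun t => f t i j) (f' i j) y)
    (hg : ∀ i j, HasFDerivAt (fun t => g t i j) (g' i j) y) :
    ∃ D : E →L[ℝ] ℝ, HasFDerivAt (fun t => polarDet (f t) (g t)) D y ∧ ∀ v : E, D v =
      polarDet (Matrix.of fun i j => f' i j v) (g y) +
      polarDet (f y) (Matrix.of fun i j => g' i j v) := by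
  have h1 := (hf 0 0).fun_mul (hg 1 1)
  have h2 := (hf 1 1).fun_mul (hg 0 0)
  have h3 := (hf 0 1).fun_mul (hg 1 0)
  have h4 := (hf 1 0).fun_mul (hg 0 1)
  have h := ((h1.fun_add h2).fun_sub h3).fun_sub h4
  refine ⟨_, h, fun v => ?_⟩
  change (f y 0 0 * g' 1 1 v + g y 1 1 * f' 0 0 v) + (f y 1 1 * g' 0 0 v + g y 0 0 * f' 1 1 v)
    - (f y 0 1 * g' 1 0 v + g y 1 0 * f' 0 1 v) - (f y 1 0 * g' 0 1 v + g y 0 1 * f' 1 0 v) =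
    (f' 0 0 v * g y 1 1 + f' 1 1 v * g y 0 0 - f' 0 1 v * g y 1 0 - f' 1 0 v * g y 0 1) +
    (f y 0 0 * g' 1 1 v + f y 1 1 * g' 0 0 v - f y 0 1 * g' 1 0 v - f y 1 0 * g' 0 1 v)
  ring

/-- The derivative of `det N = 1`. -/
theorem polarDet_slVelocity_slVelocityDeriv (y v : AdS × ℂ) :
    polarDet (slVelocity y) (slVelocityDeriv y v) = 0 := by
  obtain ⟨D, hD, hD'⟩ := exists_hasFDerivAt_polarDet (f := slVelocity) (g := slVelocity)
    (fun i j => hasFDerivAt_slVelocity i j y) (fun i j => hasFDerivAt_slVelocity i j y)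
  have h := hD.unique ((hasFDerivAt_const (2 : ℝ) y).congr_of_eventuallyEq
    (Filter.Eventually.of_forall fun y => by simp [polarDet_self, slVelocity_det]))
  have h2 : _ = polarDet (slVelocityDeriv y v) (slVelocity y) +
    polarDet (slVelocity y) (slVelocityDeriv y v) := hD' v
  rw [h, polarDet_comm] at h2
  simp at h2
  linarith

/-- The derivative of the orthogonality of position and velocity. -/
theorem polarDet_slCoverDeriv_add (y v : AdS × ℂ) :
    polarDet (slCoverDeriv y.1 v.1) (slVelocity y) +
      polarDet (slCover y.1).val (slVelocityDeriv y v) = 0 := by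
  obtain ⟨D, hD, hD'⟩ := exists_hasFDerivAt_polarDet (f := fun y : AdS × ℂ => (slCover y.1).val)
    (g := slVelocity) (fun i j => hasFDerivAt_slCover_fst i j y)
    (fun i j => hasFDerivAt_slVelocity i j y)
  have h := hD.unique ((hasFDerivAt_const (0 : ℝ) y).congr_of_eventuallyEq
    (Filter.Eventually.of_forall fun y => polarDet_slVelocity y))
  have h2 : _ = polarDet (slCoverDeriv y.1 v.1) (slVelocity y) +
    polarDet (slCover y.1).val (slVelocityDeriv y v) := hD' v
  rw [← h2, h]
  rfl

/-- The exterior derivative of the connection form in coordinates. -/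
theorem extDeriv_connectionForm (y : AdS × ℂ) (v : Fin 2 → AdS × ℂ) :
    extDeriv (E := AdS × ℂ) (F := ℝ) (n := 1)
      (fun y => connectionForm (unitFutureTangentHomeo.symm y)) y v =
    (1 / 2) * (polarDet (slVelocityDeriv y (v 0)) (slCoverDeriv y.1 (v 1).1) -
      polarDet (slVelocityDeriv y (v 1)) (slCoverDeriv y.1 (v 0).1)) := by
  let dF : Fin 2 → Fin 2 → AdS × ℂ → (AdS × ℂ →L[ℝ] ℝ) := fun i j y =>
    fderiv ℝ (fun x => slCover x i j) y.1 ∘L ContinuousLinearMap.fst ℝ AdS ℂ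
  -- This is `½ polarDet (N, dg)`: the minus sign in `ω` cancels the one in the metric.
  let A : AdS × ℂ → (AdS × ℂ →L[ℝ] ℝ) := fun y => (1 / 2 : ℝ) •
    (slVelocity y 0 0 • dF 1 1 y + slVelocity y 1 1 • dF 0 0 y
      - slVelocity y 0 1 • dF 1 0 y - slVelocity y 1 0 • dF 0 1 y)
  have hA : (fun y => connectionForm (unitFutureTangentHomeo.symm y)) =
      fun y => ContinuousAlternatingMap.ofSubsingleton ℝ (AdS × ℂ) ℝ (0 : Fin 1) (A y) := by
    funext y
    refine ContinuousAlternatingMap.ext fun v => ?_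
    refine (connectionForm_apply _ _).trans ?_
    change -adsMetric y.1 (y.2, futureCoord y) (v 0).1 = A y (v 0)
    rw [adsMetric_eq_polarDet]
    change _ = (1 / 2 : ℝ) * polarDet (slVelocity y) (slCoverDeriv y.1 (v 0).1)
    rw [slVelocity]
    ring
  have hdF : ∀ i j, ∃ D : AdS × ℂ →L[ℝ] (AdS × ℂ →L[ℝ] ℝ), HasFDerivAt (dF i j) D y ∧
      ∀ v w, D v w = slCoverHess y.1 v.1 w.1 i j := fun i j =>
    ⟨_, ((hasFDerivAt_fderiv_slCover i j y.1).comp y hasFDerivAt_fst).clm_comp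
      (hasFDerivAt_const _ y), fun v w => by simp [slCoverHess]⟩
  choose D hD hD' using hdF
  have hN := fun i j => hasFDerivAt_slVelocity i j y
  have h := (((((hN 0 0).smul (hD 1 1)).add ((hN 1 1).smul (hD 0 0))).sub
    ((hN 0 1).smul (hD 1 0))).sub ((hN 1 0).smul (hD 0 1))).const_smul (1 / 2 : ℝ)
  rw [hA, extDeriv_ofSubsingleton (A := A) h]
  -- The terms that differentiate `dg` contain the symmetric Hessian and drop out of the
  -- alternation.
  simp [hD', dF, polarDet, slVelocityDeriv, slCoverDeriv, slCoverHess_comm _ (v 1).1 (v 0).1]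
  ring

end Curvature

/-! ### Assembly on the quotients -/

section MainTheorem

theorem adjugate_mul_apply_zero_zero (A B : Matrix (Fin 2) (Fin 2) ℝ) :
    (A.adjugate * B) 0 0 = A 1 1 * B 0 0 - A 0 1 * B 1 0 := by
  simp [Matrix.adjugate_fin_two, Matrix.mul_apply, sub_eq_add_neg]

theorem adjugate_mul_apply_one_zero (A B : Matrix (Fin 2) (Fin 2) ℝ) :
    (A.adjugate * B) 1 0 = A 0 0 * B 1 0 - A 1 0 * B 0 0 := by
  simp [Matrix.adjugate_fin_two, Matrix.mul_apply]
  ring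

theorem mul_adjugate_apply_zero_zero (A B : Matrix (Fin 2) (Fin 2) ℝ) :
    (B * A.adjugate) 0 0 = B 0 0 * A 1 1 - B 0 1 * A 1 0 := by
  simp [Matrix.adjugate_fin_two, Matrix.mul_apply, sub_eq_add_neg]

theorem mul_adjugate_apply_one_zero (A B : Matrix (Fin 2) (Fin 2) ℝ) :
    (B * A.adjugate) 1 0 = B 1 0 * A 1 1 - B 1 1 * A 1 0 := by
  simp [Matrix.adjugate_fin_two, Matrix.mul_apply, sub_eq_add_neg]

/-- In coordinates, the canonical symplectic form is the difference of the pullbacks of the area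
form by the two components of the projection to the space of timelike geodesics. -/
theorem exists_hasMFDerivAt_endpoints (y : AdS × ℂ) : ∃ D₁ D₂ : AdS × ℂ →L[ℝ] ℂ,
    HasMFDerivAt 𝓘(ℝ, AdS × ℂ) 𝓘(ℝ, ℂ)
      (fun y => (geodesicProj (unitFutureTangentHomeo.symm y)).1) y D₁ ∧
    HasMFDerivAt 𝓘(ℝ, AdS × ℂ) 𝓘(ℝ, ℂ)
      (fun y => (geodesicProj (unitFutureTangentHomeo.symm y)).2) y D₂ ∧
    ∀ v : Fin 2 → AdS × ℂ,
      polarDet (slVelocityDeriv y (v 0)) (slCoverDeriv y.1 (v 1).1) -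
        polarDet (slVelocityDeriv y (v 1)) (slCoverDeriv y.1 (v 0).1) =
      hyperbolicAreaForm (geodesicProj (unitFutureTangentHomeo.symm y)).1 (fun i => D₁ (v i)) -
        hyperbolicAreaForm (geodesicProj (unitFutureTangentHomeo.symm y)).2 (fun i => D₂ (v i)) := by
  have hf := fun i j => hasFDerivAt_slCover_fst i j y
  have hN := fun i j => hasFDerivAt_slVelocity i j y
  -- The entries `0 0` and `1 0` of `N g⁻¹` (index 1) and of `g⁻¹ N` (index 2), written with the
  -- adjugate so that they are polynomial in `g` and `N`.
  have a₁ := ((hN 0 0).fun_mul (hf 1 1)).fun_sub ((hN 0 1).fun_mul (hf 1 0))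
  have c₁ := ((hN 1 0).fun_mul (hf 1 1)).fun_sub ((hN 1 1).fun_mul (hf 1 0))
  have a₂ := ((hf 1 1).fun_mul (hN 0 0)).fun_sub ((hf 0 1).fun_mul (hN 1 0))
  have c₂ := ((hf 0 0).fun_mul (hN 1 0)).fun_sub ((hf 1 0).fun_mul (hN 0 0))
  have hX : ∀ y, slVelocity y 1 0 * slCover y.1 1 1 - slVelocity y 1 1 * slCover y.1 1 0 < 0 ∧
      ((geodesicProj (unitFutureTangentHomeo.symm y)).1 : ℂ) =
      ((slVelocity y 0 0 * slCover y.1 1 1 - slVelocity y 0 1 * slCover y.1 1 0 : ℝ) - Complex.I) /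
      (slVelocity y 1 0 * slCover y.1 1 1 - slVelocity y 1 1 * slCover y.1 1 0 : ℝ) := fun y => by
    have h := coe_slCover_smul_rightPoint (unitFutureTangentHomeo.symm y)
    rw [Matrix.SpecialLinearGroup.coe_inv, mul_adjugate_apply_zero_zero,
      mul_adjugate_apply_one_zero] at h
    rw [geodesicProj_eq]
    exact h
  have hY : ∀ y, slCover y.1 0 0 * slVelocity y 1 0 - slCover y.1 1 0 * slVelocity y 0 0 < 0 ∧
      ((geodesicProj (unitFutureTangentHomeo.symm y)).2 : ℂ) =
      ((slCover y.1 1 1 * slVelocity y 0 0 - slCover y.1 0 1 * slVelocity y 1 0 : ℝ) - Complex.I) /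
      (slCover y.1 0 0 * slVelocity y 1 0 - slCover y.1 1 0 * slVelocity y 0 0 : ℝ) := fun y => by
    have h1 := (leftTranslate_elliptic (unitFutureTangentHomeo.symm y)).2.2
    have h2 := coe_rightPoint (unitFutureTangentHomeo.symm y)
    change (((slCover y.1)⁻¹ : SL(2, ℝ)).val * slVelocity y) 1 0 < 0 at h1
    change _ = (((((slCover y.1)⁻¹ : SL(2, ℝ)).val * slVelocity y) 0 0 : ℂ) - Complex.I) /
      (((slCover y.1)⁻¹ : SL(2, ℝ)).val * slVelocity y) 1 0 at h2
    rw [Matrix.SpecialLinearGroup.coe_inv, adjugate_mul_apply_one_zero] at h1 h2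
    rw [adjugate_mul_apply_zero_zero] at h2
    rw [geodesicProj_eq]
    exact ⟨h1, h2⟩
  obtain ⟨D₁, hD₁, area₁⟩ := hyperbolicAreaForm_of_elliptic a₁ c₁ (hX y).1 fun y => (hX y).2
  obtain ⟨D₂, hD₂, area₂⟩ := hyperbolicAreaForm_of_elliptic a₂ c₂ (hY y).1 fun y => (hY y).2
  refine ⟨D₁, D₂, hD₁, hD₂, fun v => ?_⟩
  rw [area₁, area₂]
  have hg : ∀ v, polarDet (slCover y.1).val (slCoverDeriv y.1 v) = 0 := fun v => by
    rw [polarDet_comm, polarDet_slCoverDeriv_slCover]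
  have key := symplectic_eq_area_sub_area (slCover y.1) (slVelocity_det y) (polarDet_slVelocity y)
    (hg (v 0).1) (polarDet_slVelocity_slVelocityDeriv y (v 0)) (polarDet_slCoverDeriv_add y (v 0))
    (hg (v 1).1) (polarDet_slVelocity_slVelocityDeriv y (v 1)) (polarDet_slCoverDeriv_add y (v 1))
    (by rw [adjugate_mul_apply_one_zero]; exact (hY y).1.ne)
    (by rw [mul_adjugate_apply_one_zero]; exact (hX y).1.ne)
  rw [key]
  simp only [Matrix.add_apply, adjugate_mul_apply_one_zero, adjugate_mul_apply_zero_zero,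
    mul_adjugate_apply_one_zero, mul_adjugate_apply_zero_zero, slVelocityDeriv, Matrix.of_apply,
    add_apply, sub_apply, smul_apply, smul_eq_mul,
    ContinuousLinearMap.comp_apply, ContinuousLinearMap.coe_fst', slCoverDeriv,
    LinearMap.coe_mk, AddHom.coe_mk]
  ring

variable {Γ : Type*} [Group Γ]

/-- The area form of the surface, pulled back to the domain of a lifted map. -/
theorem surfaceAreaForm_mfderiv_mk (ρ : Γ →* PSL(2, ℝ)) [IsFuchsian ρ] {z : ℍ}
    {q : FuchsianSurface ρ} (hq : q = Quotient.mk _ z) {D : ℂ →L[ℝ] ℂ}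
    (hD : HasMFDerivAt 𝓘(ℝ, ℂ) 𝓘(ℝ, ℂ) (Quotient.mk (MulAction.orbitRel ρ.range ℍ)) z D)
    (w : Fin 2 → ℂ) :
    surfaceAreaForm ρ q (fun i => D (w i)) = hyperbolicAreaForm z w := by
  subst hq
  rw [← pullback_surfaceAreaForm ρ]
  exact (DiffForm.pullback_apply_of_hasMFDerivAt hD _ w).symm

variable {ρl ρr : Γ →* PSL(2, ℝ)} variable [IsFuchsian ρr] (ρ : IsomLift ρl ρr)

/-- The inverse of the preferred chart at `x` is the quotient map composed with the global
parametrisation upstairs, so the local expression of `ω_ρ` is that of `ω`. -/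
theorem connectionCurvature_apply (x : PrincipalBundle ρ) (v : Fin 2 → AdS × ℂ) :
    connectionCurvature (bundleConnectionForm ρ) x v =
      extDeriv (E := AdS × ℂ) (F := ℝ) (n := 1)
        (fun y => connectionForm (unitFutureTangentHomeo.symm y))
        (unitFutureTangentHomeo (Function.surjInv Quotient.mk_surjective x)) v := by
  obtain ⟨h1, e, he, hqe, hc⟩ := PrincipalBundle.isQuotientCharted ρ x
  have hsymm : ⇑(chartAt (AdS × ℂ) x).symm =
      Quotient.mk (MulAction.orbitRel ρ.toHom.range UnitFutureTangent) ∘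
        unitFutureTangentHomeo.symm := by
    rw [hc]
    funext y
    exact (congrArg e (chartAt_symm_unitFutureTangent
      (Function.surjInv Quotient.mk_surjective x) y)).trans (congrFun hqe _).symm
  have hform : (fun y : AdS × ℂ => (bundleConnectionForm ρ
      ((chartAt (AdS × ℂ) x).symm y)).compContinuousLinearMap
      (mfderiv 𝓘(ℝ, AdS × ℂ) 𝓘(ℝ, AdS × ℂ) (chartAt (AdS × ℂ) x).symm y)) =
      fun y => connectionForm (unitFutureTangentHomeo.symm y) := by
    rw [hsymm]
    funext y
    refine ContinuousAlternatingMap.ext fun w => ?_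
    have hq := (PrincipalBundle.mdifferentiableAt_mk ρ (unitFutureTangentHomeo.symm y)).hasMFDerivAt
    have h2 := HasMFDerivAt.comp y hq (hasMFDerivAt_unitFutureTangentHomeo_symm y)
    refine (DiffForm.pullback_apply_of_hasMFDerivAt h2 (bundleConnectionForm ρ) w).trans ?_
    rw [← pullback_bundleConnectionForm ρ]
    exact (DiffForm.pullback_apply_of_hasMFDerivAt hq (bundleConnectionForm ρ) w).symm
  have hpt : chartAt (AdS × ℂ) x x =
      unitFutureTangentHomeo (Function.surjInv Quotient.mk_surjective x) := by
    have : e.symm x = Function.surjInv Quotient.mk_surjective x := by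
      rw [← e.left_inv he, ← hqe, h1]
    rw [hc]
    change unitFutureTangentHomeo (e.symm x) = _
    rw [this]
  refine (congrArg (fun α : AdS × ℂ → (AdS × ℂ) [⋀^Fin 1]→L[ℝ] ℝ =>
    extDeriv α (chartAt (AdS × ℂ) x x) fun i =>
      mfderiv 𝓘(ℝ, AdS × ℂ) 𝓘(ℝ, AdS × ℂ) (chartAt (AdS × ℂ) x) x (v i)) hform).trans ?_
  rw [(hasMFDerivAt_chartAt x).mfderiv, hpt]
  rfl

end MainTheorem

theorem mainTheorem3 {Γ : Type*} [Group Γ] (ρl ρr : Γ →* PSL(2, ℝ)) [IsFuchsian ρl] [IsFuchsian ρr]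
    (ρ : IsomLift ρl ρr) :
    connectionCurvature (bundleConnectionForm ρ) =
      (1 / 2 : ℝ) • (surfaceSymplecticForm ρl ρr).pullback (bundleProj ρ) := by
  funext x
  refine ContinuousAlternatingMap.ext fun v => ?_
  change Fin 2 → AdS × ℂ at v
  refine (connectionCurvature_apply ρ x v).trans ?_
  rw [extDeriv_connectionForm]
  set m := Function.surjInv Quotient.mk_surjective x with hm
  set y := unitFutureTangentHomeo m with hy
  have hmy : unitFutureTangentHomeo.symm y = m := Homeomorph.symm_apply_apply _ _
  have hx : Quotient.mk _ m = x := Function.surjInv_eq _ x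
  obtain ⟨D₁, D₂, h₁, h₂, key⟩ := exists_hasMFDerivAt_endpoints y
  have hq₁ := (FuchsianSurface.mdifferentiableAt_mk ρl
    (geodesicProj (unitFutureTangentHomeo.symm y)).1).hasMFDerivAt
  have hq₂ := (FuchsianSurface.mdifferentiableAt_mk ρr
    (geodesicProj (unitFutureTangentHomeo.symm y)).2).hasMFDerivAt
  have hchart := hasMFDerivAt_chartAt (E := AdS × ℂ) m
  -- Composed with the quotient map of the bundle, each component of `π_ρ` is an endpoint map
  -- followed by the quotient map of a surface; its derivative is therefore computed upstairs.
  have hl := (PrincipalBundle.isQuotientCharted ρ).hasMFDerivAt_of_comp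
    (f := fun x => (bundleProj ρ x).1) x
    ((HasMFDerivAt.comp m (HasMFDerivAt.comp y hq₁ h₁) hchart).congr_of_eventuallyEq
      (Filter.Eventually.of_forall fun n => by simp [bundleProj_mk]))
  have hr := (PrincipalBundle.isQuotientCharted ρ).hasMFDerivAt_of_comp
    (f := fun x => (bundleProj ρ x).2) x
    ((HasMFDerivAt.comp m (HasMFDerivAt.comp y hq₂ h₂) hchart).congr_of_eventuallyEq
      (Filter.Eventually.of_forall fun n => by simp [bundleProj_mk]))
  have hproj := (hl.prodMk hr).mfderiv
  have hpt : bundleProj ρ x = (Quotient.mk _ (geodesicProj (unitFutureTangentHomeo.symm y)).1,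
      Quotient.mk _ (geodesicProj (unitFutureTangentHomeo.symm y)).2) := by
    rw [hmy, ← hx, bundleProj_mk]
  -- The derivatives of the surface quotient maps are absorbed here: the surface area form on
  -- projected vectors equals the hyperbolic area form on the vectors upstairs.
  have e₁ := surfaceAreaForm_mfderiv_mk ρl (congrArg Prod.fst hpt) hq₁ fun i => D₁ (v i)
  have e₂ := surfaceAreaForm_mfderiv_mk ρr (congrArg Prod.snd hpt) hq₂ fun i => D₂ (v i)
  rw [key, ← e₁, ← e₂]
  simp only [surfaceSymplecticForm, DiffForm.pullback, Pi.smul_apply, Pi.sub_apply]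
  change _ = (1 / 2 : ℝ) * _
  congr 1
  erw [hproj]
  rw [mfderiv_fst, mfderiv_snd]
  rfl
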